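/- **Setting.** Let $\mathcal F_0$ be the set of densities $f$ on $\mathbb R$ with $f(x)>0$ for all $x$ and $\int_{-\infty}^0 f=\int_0^\infty f=\tfrac12$. For $f\in\mathcal F_0$ with distribution function $F$ and $n\ge 1$, let $Z_1^{(n)},\dots,Z_n^{(n)}$ be i.i.d. with density $f$ (the hypothesis $\mathcal H^{(n)}_{0;f}$), let $\mathbf Z^{(n)}_{(\cdot)}$ be the vector of their order statistics, $R_i^{(n)}$ the rank of $Z_i^{(n)}$, and $\mathbf N^{(n)}=(N_-^{(n)},N_+^{(n)})$ the numbers of negative and of positive $Z_i^{(n)}$. A function $\varphi:(0,1)\to\mathbb R$ is a *score-generating function* for the score functions $a^{(n)}((\nu,\eta);i)$ if, for every $f\in\mathcal F_0$, under $\mathcal H^{(n)}_{0;f}$, $$\mathbb E\big[\{a^{(n)}(\mathbf N^{(n)};R_1^{(n)})-\varphi(F(Z_1^{(n)}))\}^2\,\big|\,\mathbf Z^{(n)}_{(\cdot)}\big]=o_{\mathbb P}(1)\qquad (n\to\infty),$$ where the square is, for every $n\ge1$, an integrable random variable. Let $U^{(\nu)}_{(i)-}$ (resp. $U^{(\nu)}_{(i)+}$),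 $1\le i\le\nu$, be the $i$-th order statistic of a sample of $\nu$ i.i.d. random variables uniform on $(0,\tfrac12)$ (resp. on $(\tfrac12,1)$). The *exact* and *approximate* score functions associated with $\varphi$ are $$a^{(n)}_{\varphi;\mathrm{ex}/\mathrm{appr}}((\nu,\eta);i)=I[i\le\nu]\,a_{\varphi;-;\mathrm{ex}/\mathrm{appr}}(\nu;i)+I[i>n-\eta]\,a_{\varphi;+;\mathrm{ex}/\mathrm{appr}}(\eta;i-(n-\eta)),$$ for $\nu,\eta\ge 0$ with $\nu+\eta\le n$ and $1\le i\le n$, where, for $1\le i\le\nu$, $$a_{\varphi;-;\mathrm{ex}}(\nu;i)=\mathbb E[\varphi(U^{(\nu)}_{(i)-})],\quad a_{\varphi;+;\mathrm{ex}}(\nu;i)=\mathbb E[\varphi(U^{(\nu)}_{(i)+})],$$ $$a_{\varphi;-;\mathrm{appr}}(\nu;i)=\varphi\Big(\frac{i}{2(\nu+1)}\Big),\quad a_{\varphi;+;\mathrm{appr}}(\nu;i)=\varphi\Big(\frac12+\frac{i}{2(\nu+1)}\Big).$$ **Proposition 3.1.** Let $\varphi:(0,1)\to\mathbb R$ be a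 nonconstant square-integrable function. Then $\varphi$ is a score-generating function for $a^{(n)}_{\varphi;\mathrm{ex}}$. If, moreover, $\varphi$ is the difference of two nondecreasing square-integrable functions on $(0,1)$, then $\varphi$ is also a score-generating function for $a^{(n)}_{\varphi;\mathrm{appr}}$. -/

import Mathlib

open MeasureTheory ProbabilityTheory Filter
open scoped Topology ENNReal

universe u

namespace SignRank

/-! ### Order statistics, ranks and numbers of signs of a finite real sample -/

/-- The vector of order statistics: the sample `z` rearranged in nondecreasing order. -/
noncomputable def orderStatistics {n : ℕ} (z : Fin n → ℝ) : Fin n → ℝ := z ∘ Tuple.sort z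

/-- Order statistics are Borel functions of the sample, so that the σ-algebra they generate is a
sub-σ-algebra of the ambient one, as needed for conditioning. -/
theorem measurable_orderStatistics (n : ℕ) :
    Measurable (orderStatistics : (Fin n → ℝ) → (Fin n → ℝ)) := by
  classical
  let _ : MeasurableSpace (Equiv.Perm (Fin n)) := ⊤
  have hsort : Measurable (fun z : Fin n → ℝ => Tuple.sort z) := by
    refine measurable_to_countable' fun σ => ?_
    have hset : (fun z : Fin n → ℝ => Tuple.sort z) ⁻¹' {σ} =
        (⋂ (i : Fin n) (j : Fin n) (_ : i ≤ j), {z : Fin n → ℝ | z (σ i) ≤ z (σ j)}) ∩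
        (⋂ (i : Fin n) (j : Fin n) (_ : i < j) (_ : ¬ σ i < σ j),
          {z : Fin n → ℝ | z (σ i) = z (σ j)}ᶜ) := by
      ext z
      simp only [Set.mem_preimage, Set.mem_singleton_iff, eq_comm (a := Tuple.sort z),
        Tuple.eq_sort_iff, Set.mem_inter_iff, Set.mem_iInter, Set.mem_ofPred_eq,
        Set.mem_compl_iff, Monotone, Function.comp_apply]
      constructor
      · rintro ⟨h1, h2⟩
        exact ⟨fun i j hij => h1 hij, fun i j hij hn he => hn (h2 i j hij he)⟩
      · rintro ⟨h1, h2⟩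
        exact ⟨fun i j hij => h1 i j hij, fun i j hij he =>
          by_contra fun hn => h2 i j hij hn he⟩
    rw [hset]
    refine MeasurableSet.inter ?_ ?_
    · exact MeasurableSet.iInter fun i => MeasurableSet.iInter fun j => MeasurableSet.iInter
        fun _ => measurableSet_le (measurable_pi_apply _) (measurable_pi_apply _)
    · exact MeasurableSet.iInter fun i => MeasurableSet.iInter fun j => MeasurableSet.iInter
        fun _ => MeasurableSet.iInter fun _ =>
          (measurableSet_eq_fun (measurable_pi_apply (σ i)) (measurable_pi_apply (σ j))).compl
  refine measurable_pi_lambda _ fun i => ?_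
  have hev : Measurable (fun p : (Fin n → ℝ) × Equiv.Perm (Fin n) => p.1 (p.2 i)) :=
    measurable_from_prod_countable_left fun σ => measurable_pi_apply (σ i)
  exact hev.comp (measurable_id.prodMk hsort)

/-- The rank (from `1` to `n`) of `z i` among `z 1, …, z n`. -/
noncomputable def rank {n : ℕ} (z : Fin n → ℝ) (i : Fin n) : ℕ :=
  (Finset.univ.filter fun j => z j ≤ z i).card

/-- The number `N₋` of negative components. -/
noncomputable def numNeg {n : ℕ} (z : Fin n → ℝ) : ℕ :=
  (Finset.univ.filter fun j => z j < 0).card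

/-- The number `N₊` of positive components. -/
noncomputable def numPos {n : ℕ} (z : Fin n → ℝ) : ℕ :=
  (Finset.univ.filter fun j => 0 < z j).card

/-! ### Zero-median white noise -/

/-- `f` is a nonvanishing probability density on the real line with median zero. -/
structure IsZeroMedianDensity (f : ℝ → ℝ) : Prop where
  measurable : Measurable f
  pos : ∀ x, 0 < f x
  integrable : Integrable f
  integral_neg : ∫ x in Set.Iio (0 : ℝ), f x = 1 / 2
  integral_pos : ∫ x in Set.Ioi (0 : ℝ), f x = 1 / 2

/-- The distribution function `F` associated with the density `f`. -/
noncomputable def distFun (f : ℝ → ℝ) (x : ℝ) : ℝ := ∫ t in Set.Iic x, f t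

/-- Under `P`, the random variables `Z i` are i.i.d. with density `f`. -/
structure IsIIDWithDensity {Ω : Type*} [MeasurableSpace Ω] (P : Measure Ω) {n : ℕ}
    (Z : Fin n → Ω → ℝ) (f : ℝ → ℝ) : Prop where
  measurable : ∀ i, Measurable (Z i)
  indep : iIndepFun Z P
  law : ∀ i, P.map (Z i) = volume.withDensity fun x => ENNReal.ofReal (f x)

/-! ### Score-generating functions -/

/-- A sequence of score functions: `a n (ν, η) i` is the score `a⁽ⁿ⁾((ν, η); i)`. Only the arguments
with `η ≤ n - ν` and `1 ≤ i ≤ n` are meaningful. -/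
abbrev ScoreFunctions := ℕ → ℕ × ℕ → ℕ → ℝ

/-- The squared error `{a⁽ⁿ⁾(N⁽ⁿ⁾; R₁⁽ⁿ⁾) - φ(F(Z₁⁽ⁿ⁾))}²` for a sample of size `n = m + 1 ≥ 1`. -/
noncomputable def scoreError (φ : ℝ → ℝ) (a : ScoreFunctions) (f : ℝ → ℝ) {m : ℕ}
    (z : Fin (m + 1) → ℝ) : ℝ :=
  (a (m + 1) (numNeg z, numPos z) (rank z 0) - φ (distFun f (z 0))) ^ 2

/-- The σ-algebra generated by the vector of order statistics of the random sample `Z`. -/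
noncomputable abbrev orderSigma {Ω : Type*} {n : ℕ} (Z : Fin n → Ω → ℝ) : MeasurableSpace Ω :=
  MeasurableSpace.comap (fun ω => orderStatistics fun i => Z i ω) inferInstance

/-- `X m = o_P(1)` as `m → ∞`, where `X m` is defined on the probability space `(Ω m, P m)`. -/
def IsLittleOP {Ω : ℕ → Type*} [∀ m, MeasurableSpace (Ω m)] (P : ∀ m, Measure (Ω m))
    (X : ∀ m, Ω m → ℝ) : Prop :=
  ∀ ε : ℝ, 0 < ε → Tendsto (fun m => P m {ω | ε ≤ |X m ω|}) atTop (𝓝 0)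

/-- `φ`, of which only the values on `(0,1)` matter, is a score-generating function for `a`: for
every zero-median density `f`, whenever for each sample size `n = m + 1` the variables
`Z₁⁽ⁿ⁾, …, Zₙ⁽ⁿ⁾` are i.i.d. with density `f`, the squared error
`{a⁽ⁿ⁾(N⁽ⁿ⁾; R₁⁽ⁿ⁾) - φ(F(Z₁⁽ⁿ⁾))}²` is integrable and its conditional expectation given the vector
of order statistics is `o_P(1)`. The random samples of different sizes may live on different
probability spaces. -/
def IsScoreGenerating (φ : ℝ → ℝ) (a : ScoreFunctions) : Prop :=
  ∀ f : ℝ → ℝ, IsZeroMedianDensity f →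
  ∀ (Ω : ℕ → Type u) [∀ m, MeasurableSpace (Ω m)] (P : ∀ m, Measure (Ω m))
    [∀ m, IsProbabilityMeasure (P m)] (Z : ∀ m, Fin (m + 1) → Ω m → ℝ),
    (∀ m, IsIIDWithDensity (P m) (Z m) f) →
    (∀ m, Integrable (fun ω => scoreError φ a f fun i => Z m i ω) (P m)) ∧
    IsLittleOP P fun m =>
      (P m)[fun ω => scoreError φ a f fun i => Z m i ω | orderSigma (Z m)]

/-! ### Exact and approximate scores -/

/-- `E[φ(U₍ᵢ₎)]`, where `U₍ᵢ₎` (`1 ≤ i ≤ ν`) is the `i`-th order statistic of a sample of `ν` i.i.d.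
random variables uniformly distributed over the interval `(l, r)`. -/
noncomputable def uniformOrderMean (φ : ℝ → ℝ) (l r : ℝ) (ν i : ℕ) : ℝ :=
  if h : 1 ≤ i ∧ i ≤ ν then
    ∫ u : Fin ν → ℝ, φ (orderStatistics u ⟨i - 1, by omega⟩)
      ∂(Measure.pi fun _ => ProbabilityTheory.cond volume (Set.Ioo l r))
  else 0

/-- The score functions `a⁽ⁿ⁾((ν, η); i) = I[i ≤ ν] a₋(ν; i) + I[i > n - η] a₊(η; i - (n - η))`
built from `a₋` and `a₊`. At `(ν, η) = N⁽ⁿ⁾` and `i = Rⱼ⁽ⁿ⁾`, the two indicators are those of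
`sⱼ⁽ⁿ⁾ = -1` and `sⱼ⁽ⁿ⁾ = 1`. -/
def combineScores (aMinus aPlus : ℕ → ℕ → ℝ) : ScoreFunctions := fun n N i =>
  (if i ≤ N.1 then aMinus N.1 i else 0) +
    (if n - N.2 < i then aPlus N.2 (i - (n - N.2)) else 0)

/-- Exact scores associated with `φ`. -/
noncomputable def exactScores (φ : ℝ → ℝ) : ScoreFunctions :=
  combineScores (uniformOrderMean φ 0 (1 / 2)) (uniformOrderMean φ (1 / 2) 1)

/-- Approximate scores associated with `φ`. -/
noncomputable def approxScores (φ : ℝ → ℝ) : ScoreFunctions :=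
  combineScores (fun ν i => φ ((i : ℝ) / (2 * ((ν : ℝ) + 1))))
    (fun ν i => φ (1 / 2 + (i : ℝ) / (2 * ((ν : ℝ) + 1))))

/-- `φ` is square-integrable over `(0,1)`. -/
def SquareIntegrable (φ : ℝ → ℝ) : Prop := MemLp φ 2 (volume.restrict (Set.Ioo (0 : ℝ) 1))

end SignRank

/-! By Markov's inequality for conditional expectations (`measure_le_abs_condExp_le`) it is enough
that the unconditional mean squared error tends to zero. Since `F` is strictly increasing with `F 0
= 1/2`, replacing each observation by its value under `F` changes neither ranks nor sign counts, and
the sample becomes uniform on `(0,1)`. Its law is the equally weighted mixture, over subsets `S` of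
the indices, of laws under which the observations in `S` are uniform on `(0,1/2)` and the others on
`(1/2,1)` (`pi_smul_add_eq_sum`). Under such a component the combined score is the score of the rank
within one half-sample, so the mean squared error is a `rankRisk` for a uniform sample of size `|S|`
or `n - |S|`. Small subsets have exponentially small total weight, so it remains to show that
`rankRisk` tends to zero on each half-interval.

For a bounded uniformly continuous `ψ` scored at the grid points this holds because standardised
ranks are close to the observations in mean square (`integral_sq_gridPoint_sub_le`, a binomial
variance). A square-integrable `φ` is close to such a `ψ` in mean square. Exact scores minimise the
risk, hence do at least as well as the grid scores of `ψ`. Approximate scores sample `φ` at single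
points, where closeness in mean square says nothing in general; for monotone `φ` a value at a grid
point is squeezed between values on the two adjacent cells, so the discrete error is controlled by
the integral (`sum_sq_gridPoint_sub_le`). Differences of monotone functions follow by linearity of
the error. -/

namespace SignRank

/-! ### Ranks in a sample -/

theorem measurable_rank {n : ℕ} (k : Fin n) :
    Measurable fun z : Fin n → ℝ => rank z k := by
  simp only [rank, Finset.card_filter]
  refine Finset.measurable_sum _ fun j _ => ?_
  exact Measurable.ite (measurableSet_le (measurable_pi_apply j) (measurable_pi_apply k))
    measurable_const measurable_const

theorem one_le_rank {n : ℕ} (z : Fin n → ℝ) (k : Fin n) : 1 ≤ rank z k :=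
  Finset.card_pos.2 ⟨k, by simp⟩

theorem rank_le {n : ℕ} (z : Fin n → ℝ) (k : Fin n) : rank z k ≤ n := by
  simpa [rank] using Finset.card_filter_le (Finset.univ : Finset (Fin n)) fun j => z j ≤ z k

theorem rank_comp_perm {n : ℕ} (z : Fin n → ℝ) (σ : Equiv.Perm (Fin n)) (k : Fin n) :
    rank (z ∘ σ) k = rank z (σ k) := by
  unfold rank
  refine Finset.card_bij (fun j _ => σ j) (by simp) (fun a _ b _ h => σ.injective h) fun b hb => ?_
  exact ⟨σ.symm b, by simpa using hb, by simp⟩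

theorem rank_sort {n : ℕ} {z : Fin n → ℝ} (hz : Function.Injective z) (i : Fin n) :
    rank z (Tuple.sort z i) = i + 1 := by
  rw [← rank_comp_perm]
  have hmono : StrictMono (z ∘ Tuple.sort z) :=
    (Tuple.monotone_sort z).strictMono_of_injective (hz.comp (Tuple.sort z).injective)
  simp only [rank, hmono.le_iff_le]
  rw [show (Finset.univ.filter fun j : Fin n => j ≤ i) = Finset.Iic i by ext; simp, Fin.card_Iic]

/-- Without ties the sorting permutation lists the observations by rank. Positions are counted from
zero and ranks from one, hence `i + 1`. -/
theorem sum_rank_eq_sum_orderStatistics {n : ℕ} {z : Fin n → ℝ} (hz : Function.Injective z)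
    (g : ℕ → ℝ → ℝ) :
    ∑ k, g (rank z k) (z k) = ∑ i : Fin n, g (i + 1) (orderStatistics z i) := by
  rw [← Equiv.sum_comp (Tuple.sort z)]
  exact Finset.sum_congr rfl fun i _ => by rw [rank_sort hz]; rfl

theorem abs_score_rank_le {n : ℕ} (c : ℕ → ℝ) (z : Fin n → ℝ) (k : Fin n) :
    ‖c (rank z k)‖ ≤ ∑ i ∈ Finset.range (n + 1), |c i| := by
  rw [Real.norm_eq_abs]
  exact Finset.single_le_sum (f := fun i => |c i|) (fun i _ => abs_nonneg _)
    (Finset.mem_range.2 (Nat.lt_succ_of_le (rank_le z k)))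

theorem memLp_score_rank {n : ℕ} (c : ℕ → ℝ) (k : Fin n) (P : Measure (Fin n → ℝ))
    [IsFiniteMeasure P] (p : ℝ≥0∞) : MemLp (fun z => c (rank z k)) p P :=
  MemLp.of_bound ((measurable_of_countable c).comp (measurable_rank k)).aestronglyMeasurable _
    (ae_of_all _ fun z => abs_score_rank_le c z k)

/-! ### Samples from product measures -/

/-- A subfamily of independent coordinates is again a product sample. -/
theorem measurePreserving_pi_comp {ν n : ℕ} (μ : Fin n → Measure ℝ)
    [∀ j, IsProbabilityMeasure (μ j)] (μ' : Fin ν → Measure ℝ) {g : Fin ν → Fin n}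
    (hg : Function.Injective g) (hμ : ∀ i, μ (g i) = μ' i) :
    MeasurePreserving (fun u : Fin n → ℝ => u ∘ g) (Measure.pi μ) (Measure.pi μ') := by
  refine ⟨measurable_pi_lambda _ fun i => measurable_pi_apply _, ?_⟩
  have h1 : iIndepFun (fun j (u : Fin n → ℝ) => u j) (Measure.pi μ) :=
    iIndepFun_pi (X := fun _ => id) fun _ => aemeasurable_id
  have h2 := (iIndepFun_iff_map_fun_eq_pi_map
    (fun i => (measurable_pi_apply (g i)).aemeasurable)).1 (h1.precomp hg)
  refine h2.trans ?_
  congr 1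
  ext1 i
  rw [← hμ i]
  exact (measurePreserving_eval μ (g i)).map_eq

theorem ae_injective_pi {n : ℕ} (μ : Measure ℝ) [IsProbabilityMeasure μ] [NullSingletonClass μ] :
    ∀ᵐ u : Fin n → ℝ ∂Measure.pi fun _ => μ, Function.Injective u := by
  have key : ∀ i j : Fin n, i ≠ j → ∀ᵐ u : Fin n → ℝ ∂Measure.pi fun _ => μ, u i ≠ u j := by
    intro i j hij
    have hind : IndepFun (fun u : Fin n → ℝ => u i) (fun u => u j) (Measure.pi fun _ => μ) :=
      (iIndepFun_pi (X := fun _ : Fin n => (id : ℝ → ℝ)) fun _ => aemeasurable_id).indepFun hij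
    have hmap := (indepFun_iff_map_prod_eq_prod_map_map
      (measurable_pi_apply i).aemeasurable (measurable_pi_apply j).aemeasurable).1 hind
    have hi : Measure.map (fun u : Fin n → ℝ => u i) (Measure.pi fun _ => μ) = μ :=
      (measurePreserving_eval (fun _ : Fin n => μ) i).map_eq
    have hj : Measure.map (fun u : Fin n → ℝ => u j) (Measure.pi fun _ => μ) = μ :=
      (measurePreserving_eval (fun _ : Fin n => μ) j).map_eq
    rw [hi, hj] at hmap
    -- By Fubini the diagonal is null, its sections being single points.
    have hdiag : ∀ᵐ p : ℝ × ℝ ∂μ.prod μ, p.1 ≠ p.2 := by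
      have hms : MeasurableSet {p : ℝ × ℝ | p.1 ≠ p.2} :=
        (measurableSet_eq_fun measurable_fst measurable_snd).compl
      rw [Measure.ae_prod_iff_ae_ae hms]
      refine ae_of_all _ fun x => ?_
      have : ∀ᵐ y ∂μ, y ≠ x := by simp [ae_iff]
      filter_upwards [this] with y hy using hy.symm
    rw [← hmap] at hdiag
    have hm : Measurable fun u : Fin n → ℝ => (u i, u j) := by fun_prop
    exact ae_of_ae_map hm.aemeasurable hdiag
  have : ∀ᵐ u : Fin n → ℝ ∂Measure.pi fun _ => μ, ∀ i j : Fin n, i ≠ j → u i ≠ u j :=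
    ae_all_iff.2 fun i => ae_all_iff.2 fun j => by
      by_cases hij : i = j
      · simp [hij]
      · simpa [hij] using key i j hij
  filter_upwards [this] with u hu i j h
  by_contra hij
  exact hu i j hij h

/-- An order statistic is always one of the coordinates, so it lies in a null set only if some
coordinate does. This makes composition with an almost everywhere measurable `φ` legitimate. -/
theorem quasiMeasurePreserving_orderStatistics {n : ℕ} (μ : Measure ℝ) [IsProbabilityMeasure μ]
    (i : Fin n) :
    Measure.QuasiMeasurePreserving (fun u : Fin n → ℝ => orderStatistics u i)
      (Measure.pi fun _ => μ) μ := by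
  have hm : Measurable fun u : Fin n → ℝ => orderStatistics u i :=
    (measurable_pi_apply i).comp (measurable_orderStatistics n)
  refine ⟨hm, Measure.AbsolutelyContinuous.mk fun s hs h0 => ?_⟩
  rw [Measure.map_apply hm hs]
  refine measure_mono_null (t := ⋃ j, (fun u : Fin n → ℝ => u j) ⁻¹' s) ?_ ?_
  · intro u hu
    exact Set.mem_iUnion.2 ⟨Tuple.sort u i, hu⟩
  · refine measure_iUnion_null fun j => ?_
    exact (measurePreserving_eval (fun _ : Fin n => μ) j).quasiMeasurePreserving.preimage_null h0

theorem memLp_coordinate {n : ℕ} {μ : Measure ℝ} [IsProbabilityMeasure μ] {φ : ℝ → ℝ} {p : ℝ≥0∞}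
    (hφ : MemLp φ p μ) (k : Fin n) :
    MemLp (fun u : Fin n → ℝ => φ (u k)) p (Measure.pi fun _ => μ) :=
  hφ.comp_measurePreserving (measurePreserving_eval (fun _ : Fin n => μ) k)

theorem memLp_orderStatistics {n : ℕ} {μ : Measure ℝ} [IsProbabilityMeasure μ] {φ : ℝ → ℝ}
    {p : ℝ≥0∞} (hφ : MemLp φ p μ) (i : Fin n) :
    MemLp (fun u : Fin n → ℝ => φ (orderStatistics u i)) p (Measure.pi fun _ => μ) := by
  have hsum : MemLp (fun u : Fin n → ℝ => ∑ k, ‖φ (u k)‖) p (Measure.pi fun _ => μ) :=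
    memLp_finsetSum _ fun k _ => (memLp_coordinate hφ k).norm
  refine hsum.mono'
    (hφ.1.comp_quasiMeasurePreserving (quasiMeasurePreserving_orderStatistics μ i))
    (ae_of_all _ fun u => ?_)
  exact Finset.single_le_sum (f := fun k => ‖φ (u k)‖) (fun _ _ => norm_nonneg _)
    (Finset.mem_univ (Tuple.sort u i))

/-! ### The mean squared error of rank scores -/

/-- The mean squared error of the scores `c` of the ranks as predictors of `φ (u k)`, averaged over
the observations `u k` of a sample of size `ν` from `μ`. -/
noncomputable def rankRisk (μ : Measure ℝ) (φ : ℝ → ℝ) (c : ℕ → ℝ) (ν : ℕ) : ℝ :=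
  (ν : ℝ)⁻¹ * ∑ k : Fin ν, ∫ u : Fin ν → ℝ, (c (rank u k) - φ (u k)) ^ 2 ∂Measure.pi fun _ => μ

theorem rankRisk_nonneg (μ : Measure ℝ) (φ : ℝ → ℝ) (c : ℕ → ℝ) (ν : ℕ) :
    0 ≤ rankRisk μ φ c ν :=
  mul_nonneg (by positivity) (Finset.sum_nonneg fun _ _ => integral_nonneg fun _ => sq_nonneg _)

section RankRisk

variable {μ : Measure ℝ} [IsProbabilityMeasure μ]

theorem memLp_rankError {φ : ℝ → ℝ} (hφ : MemLp φ 2 μ) (c : ℕ → ℝ) {ν : ℕ} (k : Fin ν) :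
    MemLp (fun u : Fin ν → ℝ => c (rank u k) - φ (u k)) 2 (Measure.pi fun _ => μ) :=
  (memLp_score_rank c k _ 2).sub (memLp_coordinate hφ k)

theorem aestronglyMeasurable_rankError {φ : ℝ → ℝ} (hφ : AEStronglyMeasurable φ μ) (c : ℕ → ℝ)
    {ν : ℕ} (k : Fin ν) :
    AEStronglyMeasurable (fun u : Fin ν → ℝ => (c (rank u k) - φ (u k)) ^ 2)
      (Measure.pi fun _ => μ) :=
  ((memLp_score_rank c k _ 2).1.sub (hφ.comp_measurePreserving
    (measurePreserving_eval (fun _ : Fin ν => μ) k))).pow 2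

/-- By exchangeability the mean squared error is the same for all observations. -/
theorem integral_rankError_eq {φ : ℝ → ℝ} (hφ : AEStronglyMeasurable φ μ) (c : ℕ → ℝ) {ν : ℕ}
    (k : Fin ν) :
    ∫ u : Fin ν → ℝ, (c (rank u k) - φ (u k)) ^ 2 ∂(Measure.pi fun _ => μ) = rankRisk μ φ c ν := by
  have hall : ∀ j : Fin ν, ∫ u : Fin ν → ℝ, (c (rank u j) - φ (u j)) ^ 2 ∂(Measure.pi fun _ => μ) =
      ∫ u : Fin ν → ℝ, (c (rank u k) - φ (u k)) ^ 2 ∂(Measure.pi fun _ => μ) := by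
    intro j
    have hmp := measurePreserving_pi_comp (fun _ : Fin ν => μ) (fun _ => μ)
      (Equiv.swap j k).injective fun _ => rfl
    conv_rhs => rw [← hmp.map_eq]
    rw [integral_map hmp.measurable.aemeasurable
      (by rw [hmp.map_eq]; exact aestronglyMeasurable_rankError hφ c k)]
    simp [rank_comp_perm]
  have hν : (ν : ℝ) ≠ 0 := by
    have := k.pos
    positivity
  simp only [rankRisk, hall, Finset.sum_const, Finset.card_univ, Fintype.card_fin, nsmul_eq_mul]
  field_simp

/-- Almost surely there are no ties, so the sum over observations can be reordered by rank. The
score in each term is then a constant, which can be optimised term by term. -/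
theorem rankRisk_eq_orderStatistics [NullSingletonClass μ] {φ : ℝ → ℝ} (hφ : MemLp φ 2 μ) (c : ℕ → ℝ) (ν : ℕ) :
    rankRisk μ φ c ν = (ν : ℝ)⁻¹ * ∑ i : Fin ν,
      ∫ u : Fin ν → ℝ, (c (i + 1) - φ (orderStatistics u i)) ^ 2 ∂Measure.pi fun _ => μ := by
  unfold rankRisk
  congr 1
  have hi : ∀ i : Fin ν, Integrable (fun u : Fin ν → ℝ => (c (i + 1) - φ (orderStatistics u i)) ^ 2)
      (Measure.pi fun _ => μ) := fun i =>
    ((memLp_const (c (i + 1))).sub (memLp_orderStatistics hφ i)).integrable_sq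
  rw [← integral_finsetSum _ fun k _ => (memLp_rankError hφ c k).integrable_sq,
    ← integral_finsetSum _ fun i _ => hi i]
  refine integral_congr_ae ?_
  filter_upwards [ae_injective_pi μ] with u hu
  exact sum_rank_eq_sum_orderStatistics hu fun r x => (c r - φ x) ^ 2

theorem rankRisk_zero_left [NullSingletonClass μ] (c : ℕ → ℝ) (ν : ℕ) :
    rankRisk μ 0 c ν = (ν : ℝ)⁻¹ * ∑ i : Fin ν, c (i + 1) ^ 2 := by
  rw [rankRisk_eq_orderStatistics (φ := 0) MemLp.zero']
  simp

/-- Equality holds for `ν ≥ 1`; for `ν = 0` the risk is zero because `0⁻¹ = 0`. -/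
theorem rankRisk_zero_right_le {φ : ℝ → ℝ} (hφ : MemLp φ 2 μ) (ν : ℕ) :
    rankRisk μ φ 0 ν ≤ ∫ x, φ x ^ 2 ∂μ := by
  rcases Nat.eq_zero_or_pos ν with rfl | hν
  · simpa [rankRisk] using integral_nonneg fun x => sq_nonneg (φ x)
  · rw [← integral_rankError_eq hφ.1 0 ⟨0, hν⟩]
    have hmp := measurePreserving_eval (fun _ : Fin ν => μ) ⟨0, hν⟩
    conv_rhs => rw [← hmp.map_eq]
    rw [integral_map hmp.measurable.aemeasurable (by rw [hmp.map_eq]; exact hφ.1.pow 2)]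
    simp

/-- The error is linear in the pair (function, scores), and `(a + b)² ≤ 2a² + 2b²`. Setting one
entry of a pair to zero allows the function or the scores to be perturbed separately. -/
theorem rankRisk_add_le {φ₁ φ₂ : ℝ → ℝ} (h₁ : MemLp φ₁ 2 μ) (h₂ : MemLp φ₂ 2 μ) (c₁ c₂ : ℕ → ℝ)
    (ν : ℕ) :
    rankRisk μ (φ₁ + φ₂) (c₁ + c₂) ν ≤ 2 * rankRisk μ φ₁ c₁ ν + 2 * rankRisk μ φ₂ c₂ ν := by
  have : ∀ k : Fin ν, ∫ u : Fin ν → ℝ, ((c₁ + c₂) (rank u k) - (φ₁ + φ₂) (u k)) ^ 2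
        ∂(Measure.pi fun _ => μ) ≤
      2 * (∫ u : Fin ν → ℝ, (c₁ (rank u k) - φ₁ (u k)) ^ 2 ∂(Measure.pi fun _ => μ)) +
      2 * ∫ u : Fin ν → ℝ, (c₂ (rank u k) - φ₂ (u k)) ^ 2 ∂(Measure.pi fun _ => μ) := by
    intro k
    have i₁ := ((memLp_rankError h₁ c₁ k).integrable_sq).const_mul 2
    have i₂ := ((memLp_rankError h₂ c₂ k).integrable_sq).const_mul 2
    rw [← integral_const_mul, ← integral_const_mul, ← integral_add i₁ i₂]
    refine integral_mono (memLp_rankError (h₁.add h₂) (c₁ + c₂) k).integrable_sq (i₁.add i₂)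
      fun u => ?_
    simp only [Pi.add_apply]
    nlinarith [sq_nonneg (c₁ (rank u k) - φ₁ (u k) - (c₂ (rank u k) - φ₂ (u k)))]
  calc rankRisk μ (φ₁ + φ₂) (c₁ + c₂) ν ≤ (ν : ℝ)⁻¹ * ∑ k : Fin ν, _ :=
        mul_le_mul_of_nonneg_left (Finset.sum_le_sum fun k _ => this k) (by positivity)
    _ = _ := by
        rw [Finset.sum_add_distrib, ← Finset.mul_sum, ← Finset.mul_sum]
        unfold rankRisk
        ring

theorem rankRisk_neg (μ : Measure ℝ) (φ : ℝ → ℝ) (c : ℕ → ℝ) (ν : ℕ) :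
    rankRisk μ (-φ) (-c) ν = rankRisk μ φ c ν := by
  unfold rankRisk
  refine congrArg _ (Finset.sum_congr rfl fun k _ => integral_congr_ae (ae_of_all _ fun u => ?_))
  simp only [Pi.neg_apply]
  ring

/-- The means of `φ` at the order statistics minimise the mean squared error. -/
theorem rankRisk_le_of_eq_integral [NullSingletonClass μ] {φ : ℝ → ℝ} (hφ : MemLp φ 2 μ) {a : ℕ → ℝ} {ν : ℕ}
    (ha : ∀ i : Fin ν, a (i + 1) =
      ∫ u : Fin ν → ℝ, φ (orderStatistics u i) ∂Measure.pi fun _ => μ) (c : ℕ → ℝ) :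
    rankRisk μ φ a ν ≤ rankRisk μ φ c ν := by
  rw [rankRisk_eq_orderStatistics hφ, rankRisk_eq_orderStatistics hφ]
  refine mul_le_mul_of_nonneg_left (Finset.sum_le_sum fun i _ => ?_) (by positivity)
  have hm := memLp_orderStatistics hφ i
  have hi := hm.integrable one_le_two
  -- Only `(b - a (i + 1)) ^ 2` depends on `b`, and it vanishes at the mean.
  have expand : ∀ b : ℝ, ∫ u : Fin ν → ℝ, (b - φ (orderStatistics u i)) ^ 2
        ∂(Measure.pi fun _ => μ) =
      (b - a (i + 1)) ^ 2 - a (i + 1) ^ 2 +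
        ∫ u : Fin ν → ℝ, φ (orderStatistics u i) ^ 2 ∂(Measure.pi fun _ => μ) := by
    intro b
    have : ∀ u : Fin ν → ℝ, (b - φ (orderStatistics u i)) ^ 2 =
        b ^ 2 - 2 * b * φ (orderStatistics u i) + φ (orderStatistics u i) ^ 2 := fun u => by ring
    simp only [this]
    have i₁ : Integrable (fun _ : Fin ν → ℝ => b ^ 2) (Measure.pi fun _ => μ) := integrable_const _
    have i₂ : Integrable (fun u : Fin ν → ℝ => b ^ 2 - 2 * b * φ (orderStatistics u i))
      (Measure.pi fun _ => μ) := i₁.sub (hi.const_mul _)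
    rw [integral_add i₂ hm.integrable_sq,
      integral_sub i₁ (hi.const_mul _), integral_const_mul, ← ha i]
    simp
    ring
  rw [expand, expand]
  nlinarith [sq_nonneg (c (i + 1) - a (i + 1))]

end RankRisk

/-! ### Ranks and the distribution function -/

/-- The `1` counts the observation itself; given its value, the other terms are independent
indicators. -/
theorem rank_zero_eq {m : ℕ} (z : Fin (m + 1) → ℝ) :
    (rank z 0 : ℝ) = 1 + ∑ j : Fin m, (Set.Iic (z 0)).indicator 1 (z j.succ) := by
  rw [rank, Finset.card_filter, Fin.sum_univ_succ]
  simp [Set.indicator_apply]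

/-- The rank of an observation minus one is, conditionally on the observation, binomial; its
variance is therefore at most a quarter of the number of the other observations. -/
theorem integral_sq_rank_sub_le (μ : Measure ℝ) [IsProbabilityMeasure μ] (m : ℕ) :
    ∫ u : Fin (m + 1) → ℝ, ((rank u 0 : ℝ) - 1 - m * μ.real (Set.Iic (u 0))) ^ 2
      ∂(Measure.pi fun _ => μ) ≤ (m / 4 : ℝ) := by
  have hmono : Monotone fun x => μ.real (Set.Iic x) := fun a b hab =>
    measureReal_mono (Set.Iic_subset_Iic.2 hab)
  have hG : Measurable fun x => μ.real (Set.Iic x) := hmono.measurable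
  set H : ℝ × (Fin m → ℝ) → ℝ := fun p =>
    (∑ j : Fin m, (Set.Iic p.1).indicator 1 (p.2 j) - m * μ.real (Set.Iic p.1)) ^ 2 with hH
  have hHm : Measurable H := by
    refine Measurable.pow_const (Measurable.sub ?_ ((hG.comp measurable_fst).const_mul _)) 2
    refine Finset.measurable_sum _ fun j _ => ?_
    simp only [Set.indicator_apply, Set.mem_Iic, Pi.one_apply]
    exact Measurable.ite (measurableSet_le ((measurable_pi_apply j).comp measurable_snd)
      measurable_fst) measurable_const measurable_const
  have hmp := measurePreserving_piFinSuccAbove (fun _ : Fin (m + 1) => μ) 0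
  -- A crude bound, needed only for the integrability behind Fubini.
  have hHb : ∀ p, ‖H p‖ ≤ (m + m : ℝ) ^ 2 := by
    intro p
    have h1 : ∀ j : Fin m, (Set.Iic p.1).indicator (1 : ℝ → ℝ) (p.2 j) ∈ Set.Icc (0 : ℝ) 1 := by
      intro j
      by_cases h : p.2 j ≤ p.1 <;> simp [h]
    have h2 : ∑ j : Fin m, (Set.Iic p.1).indicator (1 : ℝ → ℝ) (p.2 j) ≤ m := by
      simpa using Finset.sum_le_card_nsmul Finset.univ _ (1 : ℝ) fun j _ => (h1 j).2
    have h3 : 0 ≤ ∑ j : Fin m, (Set.Iic p.1).indicator (1 : ℝ → ℝ) (p.2 j) :=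
      Finset.sum_nonneg fun j _ => (h1 j).1
    have h4 : (m : ℝ) * μ.real (Set.Iic p.1) ≤ m :=
      mul_le_of_le_one_right (by positivity) measureReal_le_one
    have h5 : 0 ≤ (m : ℝ) * μ.real (Set.Iic p.1) := by positivity
    rw [hH, Real.norm_eq_abs, abs_of_nonneg (sq_nonneg _)]
    exact sq_le_sq' (by linarith) (by linarith)
  have hHi : Integrable H (μ.prod (Measure.pi fun _ : Fin m => μ)) :=
    (integrable_const _).mono' hHm.aestronglyMeasurable (ae_of_all _ hHb)
  have hcomp : ∀ u : Fin (m + 1) → ℝ,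
      ((rank u 0 : ℝ) - 1 - m * μ.real (Set.Iic (u 0))) ^ 2 =
        H (MeasurableEquiv.piFinSuccAbove (fun _ => ℝ) 0 u) := by
    intro u
    rw [rank_zero_eq, hH]
    simp [MeasurableEquiv.piFinSuccAbove_apply, Fin.tail]
  simp only [hcomp]
  rw [hmp.integral_comp (MeasurableEquiv.measurableEmbedding _), integral_prod _ hHi]
  have hx : ∀ x, ∫ v : Fin m → ℝ, H (x, v) ∂(Measure.pi fun _ => μ) ≤ (m / 4 : ℝ) := by
    intro x
    set X : ℝ → ℝ := (Set.Iic x).indicator 1 with hX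
    have hXm : Measurable X := measurable_one.indicator measurableSet_Iic
    have hXb : ∀ y, X y ∈ Set.Icc (0 : ℝ) 1 := by
      intro y
      by_cases h : y ≤ x <;> simp [hX, h]
    have hXL : MemLp X 2 μ := MemLp.of_bound hXm.aestronglyMeasurable 1
      (ae_of_all _ fun y => by
        rw [Real.norm_eq_abs, abs_of_nonneg (hXb y).1]; exact (hXb y).2)
    have hXint : ∫ y, X y ∂μ = μ.real (Set.Iic x) := integral_indicator_one measurableSet_Iic
    have hmean : ∫ v : Fin m → ℝ, (∑ i, fun v : Fin m → ℝ => X (v i)) v ∂(Measure.pi fun _ => μ) =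
        m * μ.real (Set.Iic x) := by
      simp only [Finset.sum_apply]
      rw [integral_finsetSum _ fun i _ =>
        (memLp_coordinate (hXL) i).integrable one_le_two]
      have : ∀ i : Fin m, ∫ v : Fin m → ℝ, X (v i) ∂(Measure.pi fun _ => μ) =
          μ.real (Set.Iic x) := by
        intro i
        rw [← hXint]
        have hmp := measurePreserving_eval (fun _ : Fin m => μ) i
        conv_rhs => rw [← hmp.map_eq]
        rw [integral_map hmp.measurable.aemeasurable hXm.aestronglyMeasurable]
      simp [this]
    have hvar := variance_sum_pi (μ := fun _ : Fin m => μ) (X := fun _ => X) fun _ => hXL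
    rw [variance_eq_integral (by fun_prop), hmean] at hvar
    -- Popoviciu's inequality for a variable with values in `[0, 1]`.
    have hle : Var[X; μ] ≤ 1 / 4 := by
      have := variance_le_sq_of_bounded (μ := μ) (ae_of_all _ hXb) hXm.aemeasurable
      norm_num at this ⊢
      exact this
    simp only [Finset.sum_apply, Finset.sum_const, Finset.card_univ, Fintype.card_fin,
      nsmul_eq_mul] at hvar
    rw [hH]
    simp only
    rw [hvar]
    have : (0 : ℝ) ≤ m := by positivity
    nlinarith
  calc _ ≤ ∫ _, (m / 4 : ℝ) ∂μ :=
        integral_mono hHi.integral_prod_left (integrable_const _) hx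
    _ = m / 4 := by simp

/-! ### Uniform distributions on intervals -/

/-- The uniform distribution on the interval `(l, r)`. -/
noncomputable abbrev uniformIoo (l r : ℝ) : Measure ℝ := ProbabilityTheory.cond volume (Set.Ioo l r)

theorem isProbabilityMeasure_uniformIoo {l r : ℝ} (h : l < r) :
    IsProbabilityMeasure (uniformIoo l r) :=
  cond_isProbabilityMeasure_of_finite (by simpa using h) (by simp)

instance nullSingletonClass_uniformIoo (l r : ℝ) : NullSingletonClass (uniformIoo l r) :=
  ⟨fun x => cond_absolutelyContinuous (by simp)⟩

theorem ae_mem_uniformIoo (l r : ℝ) : ∀ᵐ x ∂uniformIoo l r, x ∈ Set.Ioo l r :=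
  ae_cond_mem measurableSet_Ioo

theorem uniformIoo_eq_smul {l r : ℝ} :
    uniformIoo l r = (ENNReal.ofReal (r - l))⁻¹ • volume.restrict (Set.Ioo l r) := by
  rw [uniformIoo, ProbabilityTheory.cond, Real.volume_Ioo]

theorem integral_uniformIoo {l r : ℝ} (h : l < r) (g : ℝ → ℝ) :
    ∫ x, g x ∂uniformIoo l r = (r - l)⁻¹ * ∫ x in Set.Ioo l r, g x := by
  rw [uniformIoo_eq_smul, integral_smul_measure, ENNReal.toReal_inv,
    ENNReal.toReal_ofReal (sub_pos.2 h).le, smul_eq_mul]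

theorem memLp_uniformIoo {l r : ℝ} (h : l < r) {g : ℝ → ℝ} {p : ℝ≥0∞}
    (hg : MemLp g p (volume.restrict (Set.Ioo l r))) : MemLp g p (uniformIoo l r) := by
  rw [uniformIoo_eq_smul]
  exact hg.smul_measure (by simpa using h)

theorem memLp_restrict_of_uniformIoo {l r : ℝ} (h : l < r) {g : ℝ → ℝ} {p : ℝ≥0∞}
    (hg : MemLp g p (uniformIoo l r)) : MemLp g p (volume.restrict (Set.Ioo l r)) := by
  have : volume.restrict (Set.Ioo l r) = ENNReal.ofReal (r - l) • uniformIoo l r := by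
    rw [uniformIoo_eq_smul, smul_smul, ENNReal.mul_inv_cancel (by simpa using h) (by simp), one_smul]
  rw [this]
  exact hg.smul_measure (by simp)

theorem uniformIoo_real_Iic {l r x : ℝ} (hx : x ∈ Set.Ioo l r) :
    (uniformIoo l r).real (Set.Iic x) = (x - l) / (r - l) := by
  have h : l < r := hx.1.trans hx.2
  have : Set.Ioo l r ∩ Set.Iic x = Set.Ioc l x := by
    ext y
    simp only [Set.mem_inter_iff, Set.mem_Ioo, Set.mem_Iic, Set.mem_Ioc]
    exact ⟨fun hy => ⟨hy.1.1, hy.2⟩, fun hy => ⟨⟨hy.1, hy.2.trans_lt hx.2⟩, hy.2⟩⟩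
  rw [measureReal_def, uniformIoo, cond_apply measurableSet_Ioo, this, Real.volume_Ioo,
    Real.volume_Ioc, ENNReal.toReal_mul, ENNReal.toReal_inv,
    ENNReal.toReal_ofReal (sub_pos.2 h).le, ENNReal.toReal_ofReal (sub_pos.2 hx.1).le]
  field_simp

/-- The `i`-th of the `ν` interior points that divide `(l, r)` into `ν + 1` equal intervals. -/
noncomputable def gridPoint (l r : ℝ) (ν i : ℕ) : ℝ := l + (r - l) * i / (ν + 1)

/-- The standardised rank of a uniform observation is close to the observation. -/
theorem integral_sq_gridPoint_sub_le {l r : ℝ} (h : l < r) (m : ℕ) :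
    ∫ u : Fin (m + 1) → ℝ, (gridPoint l r (m + 1) (rank u 0) - u 0) ^ 2
      ∂(Measure.pi fun _ => uniformIoo l r) ≤ (r - l) ^ 2 / (m + 2) := by
  have := isProbabilityMeasure_uniformIoo h
  have hrl : 0 < r - l := sub_pos.2 h
  have hm : (0 : ℝ) < m + 2 := by positivity
  set μ := uniformIoo l r with hμ
  have hmono : Monotone fun x => μ.real (Set.Iic x) := fun a b hab =>
    measureReal_mono (Set.Iic_subset_Iic.2 hab)
  have hi : Integrable (fun u : Fin (m + 1) → ℝ =>
      ((rank u 0 : ℝ) - 1 - m * μ.real (Set.Iic (u 0))) ^ 2) (Measure.pi fun _ => μ) := by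
    refine MemLp.integrable_sq (MemLp.sub (MemLp.sub (memLp_score_rank (fun i => (i : ℝ)) 0 _ 2)
      (memLp_const 1)) (MemLp.const_mul ?_ _))
    refine MemLp.of_bound (hmono.measurable.comp (measurable_pi_apply 0)).aestronglyMeasurable 1
      (ae_of_all _ fun u => ?_)
    rw [Real.norm_eq_abs, abs_of_nonneg measureReal_nonneg]
    exact measureReal_le_one
  have hmem : ∀ᵐ u : Fin (m + 1) → ℝ ∂(Measure.pi fun _ => μ), u 0 ∈ Set.Ioo l r :=
    (measurePreserving_eval (fun _ : Fin (m + 1) => μ) 0).quasiMeasurePreserving.ae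
      (ae_mem_uniformIoo l r)
  calc ∫ u : Fin (m + 1) → ℝ, (gridPoint l r (m + 1) (rank u 0) - u 0) ^ 2
        ∂(Measure.pi fun _ => μ)
      ≤ ∫ u : Fin (m + 1) → ℝ, ((r - l) / (m + 2)) ^ 2 *
          (2 * ((rank u 0 : ℝ) - 1 - m * μ.real (Set.Iic (u 0))) ^ 2 + 2)
          ∂(Measure.pi fun _ => μ) := by
        refine integral_mono_of_nonneg (ae_of_all _ fun u => sq_nonneg _)
          (((hi.const_mul 2).add (integrable_const 2)).const_mul _) ?_
        filter_upwards [hmem] with u hu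
        have hG := uniformIoo_real_Iic hu
        rw [← hμ] at hG
        set G := μ.real (Set.Iic (u 0)) with hGdef
        have hG0 : 0 ≤ G := measureReal_nonneg
        have hG1 : G ≤ 1 := measureReal_le_one
        have hu0 : u 0 = l + (r - l) * G := by
          rw [hG]; field_simp; ring
        -- A conditionally centred fluctuation of the rank plus a bias `1 - 2G` of absolute value at
        -- most `1`; the bias comes from standardising by `m + 2` while only `m` other observations
        -- are counted.
        have : gridPoint l r (m + 1) (rank u 0) - u 0 =
            (r - l) / (m + 2) * (((rank u 0 : ℝ) - 1 - m * G) + (1 - 2 * G)) := by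
          rw [hu0, gridPoint]; push_cast; field_simp; ring
        rw [this, mul_pow]
        refine mul_le_mul_of_nonneg_left ?_ (sq_nonneg _)
        nlinarith [sq_nonneg (((rank u 0 : ℝ) - 1 - m * G) - (1 - 2 * G))]
    _ = ((r - l) / (m + 2)) ^ 2 * (2 * ∫ u : Fin (m + 1) → ℝ,
          ((rank u 0 : ℝ) - 1 - m * μ.real (Set.Iic (u 0))) ^ 2
          ∂(Measure.pi fun _ => μ) + 2) := by
        rw [integral_const_mul, integral_add (hi.const_mul 2) (integrable_const 2),
          integral_const_mul]
        simp
    -- The binomial variance gives `2 · m/4 + 2`, enlarged to `m + 2` so that one factor cancels.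
    _ ≤ ((r - l) / (m + 2)) ^ 2 * (m + 2) := by
        refine mul_le_mul_of_nonneg_left ?_ (sq_nonneg _)
        have := integral_sq_rank_sub_le μ m
        have hm0 : (0 : ℝ) ≤ m := by positivity
        linarith
    _ = (r - l) ^ 2 / (m + 2) := by field_simp

/-! ### Consistency of rank scores -/

/-- A bounded uniformly continuous function is Lipschitz in mean square up to a small error. -/
theorem exists_sq_sub_le_add_mul_sq {ψ : ℝ → ℝ} (hu : UniformContinuous ψ) {M : ℝ}
    (hM : ∀ x, |ψ x| ≤ M) {ε : ℝ} (hε : 0 < ε) :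
    ∃ K, 0 ≤ K ∧ ∀ x y, (ψ x - ψ y) ^ 2 ≤ ε + K * (x - y) ^ 2 := by
  obtain ⟨δ, hδ, hδψ⟩ := Metric.uniformContinuous_iff.1 hu √ε (by positivity)
  -- For `|x - y| < δ` uniform continuity gives `ε`; otherwise the trivial bound `4M²` is paid for
  -- by `(x - y)² ≥ δ²`.
  refine ⟨4 * M ^ 2 / δ ^ 2, by positivity, fun x y => ?_⟩
  by_cases hxy : |x - y| < δ
  · have h1 := hδψ (a := x) (b := y) (by rwa [Real.dist_eq])
    rw [Real.dist_eq] at h1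
    have h2 : (ψ x - ψ y) ^ 2 ≤ ε := by
      rw [← sq_abs, ← Real.sq_sqrt (show 0 ≤ ε by positivity)]
      exact pow_le_pow_left₀ (abs_nonneg _) h1.le 2
    have : 0 ≤ 4 * M ^ 2 / δ ^ 2 * (x - y) ^ 2 := by positivity
    linarith
  · have h1 : δ ^ 2 ≤ (x - y) ^ 2 := by
      rw [← sq_abs (x - y)]
      exact pow_le_pow_left₀ hδ.le (not_lt.1 hxy) 2
    have h2 : (ψ x - ψ y) ^ 2 ≤ 4 * M ^ 2 := by
      have hx := abs_le.1 (hM x)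
      have hy := abs_le.1 (hM y)
      have : |ψ x - ψ y| ≤ 2 * M := abs_le.2 ⟨by linarith, by linarith⟩
      calc (ψ x - ψ y) ^ 2 = |ψ x - ψ y| ^ 2 := (sq_abs _).symm
        _ ≤ (2 * M) ^ 2 := pow_le_pow_left₀ (abs_nonneg _) this 2
        _ = 4 * M ^ 2 := by ring
    have h3 : 4 * M ^ 2 ≤ 4 * M ^ 2 / δ ^ 2 * (x - y) ^ 2 := by
      rw [div_mul_eq_mul_div, le_div_iff₀ (by positivity)]
      exact mul_le_mul_of_nonneg_left h1 (by positivity)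
    linarith

/-- Scores given by the values of a bounded uniformly continuous function at the grid points are
consistent. -/
theorem tendsto_rankRisk_of_uniformContinuous {l r : ℝ} (h : l < r) {ψ : ℝ → ℝ}
    (hu : UniformContinuous ψ) {M : ℝ} (hM : ∀ x, |ψ x| ≤ M) :
    Tendsto (fun ν => rankRisk (uniformIoo l r) ψ (fun i => ψ (gridPoint l r ν i)) ν) atTop
      (𝓝 0) := by
  have := isProbabilityMeasure_uniformIoo h
  have hψ : MemLp ψ 2 (uniformIoo l r) :=
    MemLp.of_bound hu.continuous.aestronglyMeasurable M (ae_of_all _ hM)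
  -- Sample sizes are shifted to `m + 1`, so that the observation with index `0` exists.
  rw [← tendsto_add_atTop_iff_nat 1, Metric.tendsto_atTop]
  intro ε hε
  obtain ⟨K, hK0, hpt⟩ := exists_sq_sub_le_add_mul_sq hu hM (half_pos hε)
  have hK : Tendsto (fun m : ℕ => K * (r - l) ^ 2 / ((m : ℝ) + 2)) atTop (𝓝 0) :=
    tendsto_const_nhds.div_atTop
      (tendsto_atTop_add_const_right _ 2 tendsto_natCast_atTop_atTop)
  obtain ⟨N, hN⟩ := (hK.eventually (gt_mem_nhds (half_pos hε))).exists_forall_of_atTop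
  refine ⟨N, fun m hm => ?_⟩
  rw [Real.dist_eq, sub_zero, abs_of_nonneg (rankRisk_nonneg _ _ _ _)]
  rw [← integral_rankError_eq hψ.1 _ (0 : Fin (m + 1))]
  have hid : MemLp (fun x : ℝ => x) 2 (uniformIoo l r) := by
    refine MemLp.of_bound aestronglyMeasurable_id (max |l| |r|) ?_
    filter_upwards [ae_mem_uniformIoo l r] with x hx
    exact abs_le_max_abs_abs hx.1.le hx.2.le
  have hi : Integrable (fun u : Fin (m + 1) → ℝ =>
      (gridPoint l r (m + 1) (rank u 0) - u 0) ^ 2) (Measure.pi fun _ => uniformIoo l r) :=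
    (memLp_rankError hid (gridPoint l r (m + 1)) 0).integrable_sq
  calc ∫ u : Fin (m + 1) → ℝ, (ψ (gridPoint l r (m + 1) (rank u 0)) - ψ (u 0)) ^ 2
          ∂(Measure.pi fun _ => uniformIoo l r)
      ≤ ∫ u : Fin (m + 1) → ℝ, (ε / 2 + K *
          (gridPoint l r (m + 1) (rank u 0) - u 0) ^ 2)
          ∂(Measure.pi fun _ => uniformIoo l r) :=
        integral_mono (memLp_rankError hψ (fun i => ψ (gridPoint l r (m + 1) i)) 0).integrable_sq
          ((integrable_const _).add (hi.const_mul _)) fun u => hpt _ _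
    _ = ε / 2 + K * ∫ u : Fin (m + 1) → ℝ,
          (gridPoint l r (m + 1) (rank u 0) - u 0) ^ 2
          ∂(Measure.pi fun _ => uniformIoo l r) := by
        rw [integral_add (integrable_const _) (hi.const_mul _), integral_const_mul]
        simp
    _ ≤ ε / 2 + K * ((r - l) ^ 2 / (m + 2)) := by
        gcongr
        exact integral_sq_gridPoint_sub_le h m
    _ < ε := by
        have := hN m hm
        rw [mul_div_assoc] at this
        linarith

/-- Square-integrable functions are approximated in mean square by bounded uniformly continuous
functions. -/
theorem exists_uniformContinuous_integral_sq_sub_le {μ : Measure ℝ} [IsFiniteMeasure μ]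
    {φ : ℝ → ℝ} (hφ : MemLp φ 2 μ) {ε : ℝ} (hε : 0 < ε) :
    ∃ ψ : ℝ → ℝ, UniformContinuous ψ ∧ (∃ M, ∀ x, |ψ x| ≤ M) ∧ MemLp ψ 2 μ ∧
      ∫ x, (φ x - ψ x) ^ 2 ∂μ ≤ ε := by
  obtain ⟨ψ, hsupp, hle, hcont, hmem⟩ := hφ.exists_hasCompactSupport_eLpNorm_sub_le
    (ENNReal.ofNat_ne_top) (ε := ENNReal.ofReal √ε) (by simpa using hε)
  refine ⟨ψ, hsupp.uniformContinuous_of_continuous hcont, ?_, hmem, ?_⟩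
  · obtain ⟨M, hM⟩ := hsupp.exists_bound_of_continuous hcont
    exact ⟨M, hM⟩
  · have hm := hφ.sub hmem
    have h1 := hm.eLpNorm_eq_integral_rpow_norm two_ne_zero ENNReal.ofNat_ne_top
    have h2 : ∀ x, ‖(φ - ψ) x‖ ^ (2 : ℝ≥0∞).toReal = (φ x - ψ x) ^ 2 := by
      intro x
      simp
    simp only [h2] at h1
    rw [h1, ENNReal.ofReal_le_ofReal_iff (Real.sqrt_nonneg _), Real.sqrt_eq_rpow] at hle
    rwa [show (2 : ℝ≥0∞).toReal⁻¹ = 1 / 2 by simp, Real.rpow_le_rpow_iff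
      (integral_nonneg fun _ => sq_nonneg _) hε.le (by norm_num)] at hle

/-- The pair `(φ, c)` is split as `(ψ, c) + (φ - ψ, 0)`. The cost of the approximation does not
depend on the sample size. -/
theorem rankRisk_le_of_approx {μ : Measure ℝ} [IsProbabilityMeasure μ] {φ ψ : ℝ → ℝ}
    (hφ : MemLp φ 2 μ) (hψ : MemLp ψ 2 μ) (c : ℕ → ℝ) (ν : ℕ) :
    rankRisk μ φ c ν ≤ 2 * rankRisk μ ψ c ν + 2 * ∫ x, (φ x - ψ x) ^ 2 ∂μ := by
  have h := rankRisk_add_le hψ (hφ.sub hψ) c 0 ν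
  rw [add_sub_cancel, add_zero] at h
  have := rankRisk_zero_right_le (hφ.sub hψ) ν
  simp only [Pi.sub_apply] at this
  linarith

/-- Exact scores are consistent for every square-integrable `φ`. -/
theorem tendsto_rankRisk_of_eq_integral {l r : ℝ} (h : l < r) {φ : ℝ → ℝ}
    (hφ : MemLp φ 2 (uniformIoo l r)) {a : ℕ → ℕ → ℝ}
    (ha : ∀ ν, ∀ i : Fin ν, a ν (i + 1) = ∫ u : Fin ν → ℝ, φ (orderStatistics u i)
      ∂Measure.pi fun _ => uniformIoo l r) :
    Tendsto (fun ν => rankRisk (uniformIoo l r) φ (a ν) ν) atTop (𝓝 0) := by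
  have := isProbabilityMeasure_uniformIoo h
  rw [Metric.tendsto_atTop]
  intro ε hε
  obtain ⟨ψ, hu, ⟨M, hM⟩, hψ, hle⟩ :=
    exists_uniformContinuous_integral_sq_sub_le hφ (show 0 < ε / 4 by positivity)
  obtain ⟨N, hN⟩ := ((tendsto_rankRisk_of_uniformContinuous h hu hM).eventually
    (gt_mem_nhds (show 0 < ε / 4 by positivity))).exists_forall_of_atTop
  refine ⟨N, fun ν hν => ?_⟩
  rw [Real.dist_eq, sub_zero, abs_of_nonneg (rankRisk_nonneg _ _ _ _)]
  -- The grid scores of `ψ` compete against the optimal exact scores, so `φ` itself is never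
  -- evaluated on the grid.
  have h1 := rankRisk_le_of_eq_integral hφ (ha ν) fun i => ψ (gridPoint l r ν i)
  have h2 := rankRisk_le_of_approx hφ hψ (fun i => ψ (gridPoint l r ν i)) ν
  have h3 := hN ν hν
  linarith

/-! ### Approximate scores: monotone functions at the grid points -/

theorem gridPoint_succ (l r : ℝ) (ν i : ℕ) :
    gridPoint l r ν (i + 1) = gridPoint l r ν i + (r - l) / (ν + 1) := by
  unfold gridPoint
  push_cast
  ring

theorem gridPoint_zero (l r : ℝ) (ν : ℕ) : gridPoint l r ν 0 = l := by simp [gridPoint]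

theorem gridPoint_last (l r : ℝ) (ν : ℕ) : gridPoint l r ν (ν + 1) = r := by
  unfold gridPoint
  push_cast
  field_simp
  ring

theorem monotone_gridPoint {l r : ℝ} (h : l < r) (ν : ℕ) : Monotone (gridPoint l r ν) :=
  monotone_nat_of_le_succ fun i => by
    rw [gridPoint_succ]
    have := sub_pos.2 h
    have : 0 < (r - l) / (ν + 1) := by positivity
    linarith

/-- The values at the grid points of a monotone function and of a continuous function that is close
to it in mean square are close on average. -/
theorem sum_sq_gridPoint_sub_le {l r : ℝ} (h : l < r) {φ ψ : ℝ → ℝ}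
    (hφ : MonotoneOn φ (Set.Ioo l r))
    (hi : IntegrableOn (fun x => (φ x - ψ x) ^ 2) (Set.Ioo l r)) {δ ω : ℝ}
    (hδ : ∀ x y, |x - y| < δ → |ψ x - ψ y| ≤ ω) {ν : ℕ} (hν : (r - l) / (ν + 1) < δ) :
    (r - l) / (ν + 1) * ∑ i : Fin ν,
        (φ (gridPoint l r ν (i + 1)) - ψ (gridPoint l r ν (i + 1))) ^ 2 ≤
      6 * (∫ x in Set.Ioo l r, (φ x - ψ x) ^ 2) + 3 * (r - l) * ω ^ 2 := by
  set q : ℝ → ℝ := fun x => (φ x - ψ x) ^ 2 with hq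
  set s : ℝ := (r - l) / (ν + 1) with hs
  set x : ℕ → ℝ := gridPoint l r ν with hx
  have hrl : 0 < r - l := sub_pos.2 h
  have hs0 : 0 < s := by positivity
  have hq0 : ∀ y, 0 ≤ q y := fun y => sq_nonneg _
  have hsucc : ∀ i, x (i + 1) = x i + s := fun i => gridPoint_succ l r ν i
  have hxm : Monotone x := monotone_gridPoint h ν
  have hx0 : x 0 = l := gridPoint_zero l r ν
  have hxl : x (ν + 1) = r := gridPoint_last l r ν
  have hlr : IntervalIntegrable q volume l r :=
    (intervalIntegrable_iff_integrableOn_Ioo_of_le h.le).2 hi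
  have hII : ∀ i j, i ≤ j → j ≤ ν + 1 → IntervalIntegrable q volume (x i) (x j) := by
    intro i j hij hj
    refine hlr.mono_set ?_
    rw [Set.uIcc_of_le (hxm hij), Set.uIcc_of_le h.le, ← hx0, ← hxl]
    exact Set.Icc_subset_Icc (hxm (Nat.zero_le _)) (hxm hj)
  have hsub : ∀ i j, i ≤ j → j ≤ ν + 1 → ∫ y in (x i)..(x j), q y ≤ ∫ y in l..r, q y := by
    intro i j hij hj
    refine intervalIntegral.integral_mono_interval ?_ (hxm hij) ?_ (ae_of_all _ hq0) hlr
    · rw [← hx0]; exact hxm (Nat.zero_le _)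
    · rw [← hxl]; exact hxm hj
  -- For `0 < t < s`, monotonicity gives `φ (x i + t) ≤ φ (x (i + 1)) ≤ φ (x (i + 1) + t)`, while
  -- `ψ` varies by at most `ω`. So the error at `x (i + 1)` is bounded by the errors at the two
  -- shifted points and `ω`; squaring (three terms, hence the factor 3) and integrating over `t`
  -- gives the two adjacent cells.
  have hterm : ∀ i < ν, s * q (x (i + 1)) ≤
      3 * (∫ y in (x i)..(x (i + 1)), q y) + 3 * (∫ y in (x (i + 1))..(x (i + 2)), q y) +
        3 * s * ω ^ 2 := by
    intro i hiν
    have e1 : ∫ t in (0 : ℝ)..s, q (x i + t) = ∫ y in (x i)..(x (i + 1)), q y := by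
      rw [intervalIntegral.integral_comp_add_left, add_zero, hsucc]
    have e2 : ∫ t in (0 : ℝ)..s, q (x (i + 1) + t) = ∫ y in (x (i + 1))..(x (i + 2)), q y := by
      rw [intervalIntegral.integral_comp_add_left, add_zero, ← hsucc]
    have i1 : IntervalIntegrable (fun t => q (x i + t)) volume 0 s := by
      have := (hII i (i + 1) (by omega) (by omega)).comp_add_left (x i)
      rwa [sub_self, hsucc, add_sub_cancel_left] at this
    have i2 : IntervalIntegrable (fun t => q (x (i + 1) + t)) volume 0 s := by
      have := (hII (i + 1) (i + 2) (by omega) (by omega)).comp_add_left (x (i + 1))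
      rwa [sub_self, hsucc (i + 1), add_sub_cancel_left] at this
    have hle : ∫ _ in (0 : ℝ)..s, q (x (i + 1)) ≤
        ∫ t in (0 : ℝ)..s, (3 * q (x i + t) + 3 * q (x (i + 1) + t) + 3 * ω ^ 2) := by
      refine intervalIntegral.integral_mono_on_of_le_Ioo hs0.le intervalIntegrable_const
        (((i1.const_mul 3).add (i2.const_mul 3)).add intervalIntegrable_const) fun t ht => ?_
      have b0 : l ≤ x i := hx0 ▸ hxm (Nat.zero_le i)
      have b1 : x (i + 2) ≤ r := hxl ▸ hxm (show i + 2 ≤ ν + 1 by omega)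
      have b2 := hsucc i
      have b3 := hsucc (i + 1)
      have m1 : x i + t ∈ Set.Ioo l r := ⟨by linarith [ht.1], by linarith [ht.2]⟩
      have m2 : x (i + 1) ∈ Set.Ioo l r := ⟨by linarith, by linarith⟩
      have m3 : x (i + 1) + t ∈ Set.Ioo l r := ⟨by linarith [ht.1], by linarith [ht.2]⟩
      have f1 := hφ m1 m2 (by linarith [ht.2])
      have f2 := hφ m2 m3 (by linarith [ht.1])
      have w1 := abs_le.1 (hδ (x i + t) (x (i + 1)) (by
        rw [abs_lt]; constructor <;> linarith [ht.1, ht.2]))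
      have w2 := abs_le.1 (hδ (x (i + 1) + t) (x (i + 1)) (by
        rw [abs_lt]; constructor <;> linarith [ht.1, ht.2]))
      simp only [hq]
      set A := φ (x i + t) - ψ (x i + t) with hA
      set B := φ (x (i + 1) + t) - ψ (x (i + 1) + t) with hB
      set D := φ (x (i + 1)) - ψ (x (i + 1)) with hD
      have u1 : D ≤ |A| + |B| + |ω| := by
        linarith [le_abs_self B, abs_nonneg A, le_abs_self ω]
      have u2 : -(|A| + |B| + |ω|) ≤ D := by
        linarith [neg_abs_le A, abs_nonneg B, le_abs_self ω]
      have u3 : D ^ 2 ≤ (|A| + |B| + |ω|) ^ 2 := sq_le_sq' u2 u1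
      nlinarith [sq_nonneg (|A| - |B|), sq_nonneg (|A| - |ω|), sq_nonneg (|B| - |ω|), sq_abs A,
        sq_abs B, sq_abs ω]
    rw [intervalIntegral.integral_add ((i1.const_mul 3).add (i2.const_mul 3))
        intervalIntegrable_const,
      intervalIntegral.integral_add (i1.const_mul 3) (i2.const_mul 3),
      intervalIntegral.integral_const_mul, intervalIntegral.integral_const_mul, e1, e2] at hle
    simp only [intervalIntegral.integral_const, sub_zero, smul_eq_mul] at hle
    linarith
  -- The left cells and the right cells each sum to at most the whole integral, hence `6 = 3 + 3`.
  have hs1 : ∑ i ∈ Finset.range ν, ∫ y in (x i)..(x (i + 1)), q y ≤ ∫ y in l..r, q y := by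
    rw [intervalIntegral.sum_integral_adjacent_intervals fun k hk =>
      hII k (k + 1) (by omega) (by omega)]
    exact hsub 0 ν (by omega) (by omega)
  have hs2 : ∑ i ∈ Finset.range ν, ∫ y in (x (i + 1))..(x (i + 2)), q y ≤ ∫ y in l..r, q y := by
    rw [intervalIntegral.sum_integral_adjacent_intervals (a := fun i => x (i + 1)) fun k hk =>
      hII (k + 1) (k + 2) (by omega) (by omega)]
    exact hsub 1 (ν + 1) (by omega) le_rfl
  have hsν : ν * s ≤ r - l := by
    rw [hs, mul_div_assoc', div_le_iff₀ (by positivity)]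
    nlinarith
  rw [Finset.sum_fin_eq_sum_range, Finset.mul_sum]
  calc _ = ∑ i ∈ Finset.range ν, s * q (x (i + 1)) :=
        Finset.sum_congr rfl fun i hi => by rw [dif_pos (Finset.mem_range.1 hi)]
    _ ≤ ∑ i ∈ Finset.range ν, (3 * (∫ y in (x i)..(x (i + 1)), q y) +
          3 * (∫ y in (x (i + 1))..(x (i + 2)), q y) + 3 * s * ω ^ 2) :=
        Finset.sum_le_sum fun i hi => hterm i (Finset.mem_range.1 hi)
    _ = 3 * (∑ i ∈ Finset.range ν, ∫ y in (x i)..(x (i + 1)), q y) +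
          3 * (∑ i ∈ Finset.range ν, ∫ y in (x (i + 1))..(x (i + 2)), q y) +
          3 * (ν * s) * ω ^ 2 := by
        rw [Finset.sum_add_distrib, Finset.sum_add_distrib, ← Finset.mul_sum, ← Finset.mul_sum]
        simp
        ring
    _ ≤ 3 * (∫ y in l..r, q y) + 3 * (∫ y in l..r, q y) + 3 * (r - l) * ω ^ 2 := by
        gcongr
    _ = _ := by
        rw [intervalIntegral.integral_of_le h.le, integral_Ioc_eq_integral_Ioo]
        ring

/-- Approximate scores are consistent for monotone square-integrable `φ`. -/
theorem tendsto_rankRisk_of_monotoneOn {l r : ℝ} (h : l < r) {φ : ℝ → ℝ}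
    (hφ : MemLp φ 2 (uniformIoo l r)) (hmono : MonotoneOn φ (Set.Ioo l r)) :
    Tendsto (fun ν => rankRisk (uniformIoo l r) φ (fun i => φ (gridPoint l r ν i)) ν) atTop
      (𝓝 0) := by
  have := isProbabilityMeasure_uniformIoo h
  have hrl : 0 < r - l := sub_pos.2 h
  rw [Metric.tendsto_atTop]
  intro ε hε
  obtain ⟨ψ, hu, ⟨M, hM⟩, hψ, hle⟩ :=
    -- With `e = ε / 120`, the final total is `2 · 18e + 2 · (2e + 2e) = 44e < ε`.
    exists_uniformContinuous_integral_sq_sub_le hφ (show 0 < ε / 120 by positivity)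
  obtain ⟨δ, hδ, hδψ⟩ := Metric.uniformContinuous_iff.1 hu (√(ε / 120)) (by positivity)
  have hstep : Tendsto (fun ν : ℕ => (r - l) / ((ν : ℝ) + 1)) atTop (𝓝 0) :=
    tendsto_const_nhds.div_atTop (tendsto_atTop_add_const_right _ 1 tendsto_natCast_atTop_atTop)
  obtain ⟨N, hN⟩ := (((tendsto_rankRisk_of_uniformContinuous h hu hM).eventually
    (gt_mem_nhds (show 0 < ε / 120 by positivity))).and
      ((hstep.eventually (gt_mem_nhds hδ)).and (eventually_ge_atTop 1))).exists_forall_of_atTop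
  refine ⟨N, fun ν hν => ?_⟩
  obtain ⟨h1, h2, h3⟩ := hN ν hν
  rw [Real.dist_eq, sub_zero, abs_of_nonneg (rankRisk_nonneg _ _ _ _)]
  have hint := (memLp_restrict_of_uniformIoo h (hφ.sub hψ)).integrable_sq
  have h4 := sum_sq_gridPoint_sub_le h hmono hint (ω := √(ε / 120)) (fun x y hxy => by
    have := hδψ (a := x) (b := y) (by rwa [Real.dist_eq])
    rw [Real.dist_eq] at this
    exact this.le) h2
  rw [Real.sq_sqrt (by positivity)] at h4
  rw [integral_uniformIoo h] at hle
  set I := ∫ x in Set.Ioo l r, (φ x - ψ x) ^ 2 with hI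
  have hI' : I ≤ (r - l) * (ε / 120) := by
    rwa [inv_mul_le_iff₀ hrl] at hle
  set S := ∑ i : Fin ν, (φ (gridPoint l r ν (i + 1)) - ψ (gridPoint l r ν (i + 1))) ^ 2 with hS
  have hS0 : 0 ≤ S := Finset.sum_nonneg fun _ _ => sq_nonneg _
  have hν1 : (1 : ℝ) ≤ ν := by exact_mod_cast h3
  -- The constant is `9 = 6 + 3`, doubled because `(ν + 1) / ν ≤ 2`.
  have h5 : (ν : ℝ)⁻¹ * S ≤ 18 * (ε / 120) := by
    have : (r - l) * (S / (ν + 1)) ≤ (r - l) * (9 * (ε / 120)) := by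
      calc (r - l) * (S / (ν + 1)) = (r - l) / (ν + 1) * S := by ring
        _ ≤ 6 * I + 3 * (r - l) * (ε / 120) := h4
        _ ≤ 6 * ((r - l) * (ε / 120)) + 3 * (r - l) * (ε / 120) := by gcongr
        _ = _ := by ring
    have h6 := le_of_mul_le_mul_left this hrl
    rw [div_le_iff₀ (by positivity)] at h6
    rw [inv_mul_le_iff₀ (by positivity)]
    nlinarith
  have h7 := rankRisk_le_of_approx hφ hψ (fun i => ψ (gridPoint l r ν i)) ν
  -- Here the scores are perturbed: with the function `0`, the risk of the score difference is the
  -- deterministic average `S / ν`.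
  have h8 := rankRisk_add_le (μ := uniformIoo l r) (φ₁ := 0) MemLp.zero' hφ
    (fun i => φ (gridPoint l r ν i) - ψ (gridPoint l r ν i)) (fun i => ψ (gridPoint l r ν i)) ν
  rw [rankRisk_zero_left, zero_add] at h8
  have h9 : (fun i => φ (gridPoint l r ν i) - ψ (gridPoint l r ν i)) +
      (fun i => ψ (gridPoint l r ν i)) = fun i => φ (gridPoint l r ν i) := by
    ext i; simp
  rw [h9] at h8
  rw [integral_uniformIoo h] at h7
  linarith

/-- Approximate scores are consistent for differences of monotone square-integrable functions. -/
theorem tendsto_rankRisk_of_eqOn_sub {l r : ℝ} (h : l < r) {φ φ₁ φ₂ : ℝ → ℝ}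
    (h₁ : MemLp φ₁ 2 (uniformIoo l r)) (h₂ : MemLp φ₂ 2 (uniformIoo l r))
    (m₁ : MonotoneOn φ₁ (Set.Ioo l r)) (m₂ : MonotoneOn φ₂ (Set.Ioo l r))
    (hφ : ∀ x ∈ Set.Ioo l r, φ x = φ₁ x - φ₂ x) :
    Tendsto (fun ν => rankRisk (uniformIoo l r) φ (fun i => φ (gridPoint l r ν i)) ν) atTop
      (𝓝 0) := by
  have := isProbabilityMeasure_uniformIoo h
  have hrl : 0 < r - l := sub_pos.2 h
  have hlim := ((tendsto_rankRisk_of_monotoneOn h h₁ m₁).const_mul 2).add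
    ((tendsto_rankRisk_of_monotoneOn h h₂ m₂).const_mul 2)
  rw [mul_zero, add_zero] at hlim
  refine squeeze_zero (fun ν => rankRisk_nonneg _ _ _ _) (fun ν => ?_) hlim
  have hadd := rankRisk_add_le h₁ h₂.neg (fun i => φ₁ (gridPoint l r ν i))
    (-fun i => φ₂ (gridPoint l r ν i)) ν
  rw [rankRisk_neg] at hadd
  refine le_of_eq_of_le ?_ hadd
  refine congrArg _ (Finset.sum_congr rfl fun k _ => integral_congr_ae ?_)
  filter_upwards [(measurePreserving_eval (fun _ : Fin ν => uniformIoo l r)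
    k).quasiMeasurePreserving.ae (ae_mem_uniformIoo l r)] with u hu
  -- Ranks lie between `1` and `ν`, so the scores use `φ` only inside the interval, where the
  -- decomposition is valid.
  have hgrid : gridPoint l r ν (rank u k) ∈ Set.Ioo l r := by
    have hr1 : (1 : ℝ) ≤ rank u k := by exact_mod_cast one_le_rank u k
    have hr2 : (rank u k : ℝ) ≤ ν := by exact_mod_cast rank_le u k
    unfold gridPoint
    constructor
    · have : 0 < (r - l) * rank u k / (ν + 1) := by positivity
      linarith
    · have : (r - l) * rank u k / (ν + 1) < r - l := by
        rw [div_lt_iff₀ (by positivity)]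
        nlinarith
      linarith
  have hu' : φ (u k) = φ₁ (u k) - φ₂ (u k) := hφ _ hu
  simp only [Pi.add_apply, Pi.neg_apply, hu', hφ _ hgrid]
  ring

/-! ### Conditioning on the signs -/

/-- On boxes this is the expansion of a product of sums over subsets, and boxes determine the
product measure. The set `S` records the coordinates drawn from `μ₁`. -/
theorem pi_smul_add_eq_sum {n : ℕ} (a : ℝ≥0∞) (ha : a ≠ ∞) (μ₁ μ₂ : Measure ℝ)
    [IsFiniteMeasure μ₁] [IsFiniteMeasure μ₂] :
    Measure.pi (fun _ : Fin n => a • (μ₁ + μ₂)) =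
      ∑ S : Finset (Fin n), a ^ n • Measure.pi fun j => if j ∈ S then μ₁ else μ₂ := by
  have hfin : ∀ (S : Finset (Fin n)) j, IsFiniteMeasure (if j ∈ S then μ₁ else μ₂) := by
    intro S j
    split_ifs <;> infer_instance
  have : IsFiniteMeasure (a • (μ₁ + μ₂)) := Measure.smul_finite _ ha
  refine Measure.pi_eq (μ := fun _ : Fin n => a • (μ₁ + μ₂)) fun s _ => ?_
  simp only [Measure.finsetSum_apply, Measure.smul_apply, smul_eq_mul, Measure.pi_pi,
    Measure.add_apply]
  rw [Finset.prod_mul_distrib, Finset.prod_const, Finset.card_univ, Fintype.card_fin,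
    Finset.prod_add, Finset.powerset_univ, Finset.mul_sum]
  refine Finset.sum_congr rfl fun S _ => ?_
  congr 1
  rw [← Finset.prod_sdiff (Finset.subset_univ S), mul_comm]
  congr 1
  · exact Finset.prod_congr rfl fun j hj => by simp [hj]
  · exact Finset.prod_congr rfl fun j hj => by simp [(Finset.mem_sdiff.1 hj).2]

theorem uniformIoo_zero_one_eq :
    uniformIoo 0 1 = (2 : ℝ≥0∞)⁻¹ • (uniformIoo 0 (1 / 2) + uniformIoo (1 / 2) 1) := by
  have h2 : ENNReal.ofReal (1 / 2 - 0) = 2⁻¹ := by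
    rw [sub_zero, one_div, ENNReal.ofReal_inv_of_pos two_pos]; simp
  have h3 : ENNReal.ofReal (1 - 1 / 2) = 2⁻¹ := by
    rw [show (1 : ℝ) - 1 / 2 = 1 / 2 - 0 by norm_num, h2]
  have hU : volume.restrict (Set.Ioo (0 : ℝ) 1) =
      volume.restrict (Set.Ioo (0 : ℝ) (1 / 2)) + volume.restrict (Set.Ioo (1 / 2 : ℝ) 1) := by
    rw [← Measure.restrict_union
      (Set.disjoint_left.2 fun x hx hx' => lt_asymm hx.2 hx'.1) measurableSet_Ioo]
    refine Measure.restrict_congr_set ?_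
    have : ∀ᵐ x : ℝ, x ≠ 1 / 2 := by simp [ae_iff]
    filter_upwards [this] with x hx
    refine propext ⟨fun h => ?_, fun h => ?_⟩
    · rcases lt_or_gt_of_ne hx with h' | h'
      · exact Or.inl ⟨h.1, h'⟩
      · exact Or.inr ⟨h', h.2⟩
    · rcases h with h | h
      · exact ⟨h.1, by linarith [h.2]⟩
      · exact ⟨by linarith [h.1], h.2⟩
  rw [uniformIoo_eq_smul, uniformIoo_eq_smul, uniformIoo_eq_smul, h2, h3, hU, sub_zero, inv_inv,
    ← smul_add, smul_smul, ENNReal.inv_mul_cancel two_ne_zero ENNReal.ofNat_ne_top]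
  simp

/-- The rank in a sample is the rank in a subsample plus the number of smaller or equal
observations outside the subsample. -/
theorem rank_apply_eq_add {n ν : ℕ} (u : Fin n → ℝ) (S : Finset (Fin n)) (g : Fin ν ↪ Fin n)
    (hg : Finset.univ.map g = S) (k : Fin ν) :
    rank u (g k) = rank (u ∘ g) k + (Sᶜ.filter fun j => u j ≤ u (g k)).card := by
  unfold rank
  rw [← Finset.union_compl S, Finset.filter_union, Finset.card_union_of_disjoint
    (Finset.disjoint_filter_filter disjoint_compl_right), ← hg, Finset.filter_map, Finset.card_map]
  rfl

/-- The law of the `j`-th standardised observation when `S` is the set of the indices of the negative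
observations. -/
noncomputable def halfUniform {n : ℕ} (S : Finset (Fin n)) (j : Fin n) : Measure ℝ :=
  if j ∈ S then uniformIoo 0 (1 / 2) else uniformIoo (1 / 2) 1

instance isProbabilityMeasure_halfUniform {n : ℕ} (S : Finset (Fin n)) (j : Fin n) :
    IsProbabilityMeasure (halfUniform S j) := by
  unfold halfUniform
  split_ifs
  · exact isProbabilityMeasure_uniformIoo (by norm_num)
  · exact isProbabilityMeasure_uniformIoo (by norm_num)

theorem ae_lt_half_iff_mem {n : ℕ} (S : Finset (Fin n)) :
    ∀ᵐ u ∂Measure.pi (halfUniform S), ∀ j, (j ∈ S → u j < 1 / 2) ∧ (j ∉ S → 1 / 2 < u j) := by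
  refine ae_all_iff.2 fun j => ?_
  refine (measurePreserving_eval (halfUniform S) j).quasiMeasurePreserving.ae
    (p := fun x : ℝ => (j ∈ S → x < 1 / 2) ∧ (j ∉ S → 1 / 2 < x)) ?_
  by_cases hj : j ∈ S
  · rw [halfUniform, if_pos hj]
    filter_upwards [ae_mem_uniformIoo 0 (1 / 2)] with x hx
    exact ⟨fun _ => hx.2, fun h => absurd hj h⟩
  · rw [halfUniform, if_neg hj]
    filter_upwards [ae_mem_uniformIoo (1 / 2) 1] with x hx
    exact ⟨fun h => absurd h hj, fun _ => hx.1⟩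

theorem filter_lt_half_eq {n : ℕ} {S : Finset (Fin n)} {u : Fin n → ℝ}
    (hu : ∀ j, (j ∈ S → u j < 1 / 2) ∧ (j ∉ S → 1 / 2 < u j)) :
    (Finset.univ.filter fun j => u j < 1 / 2) = S ∧
      (Finset.univ.filter fun j => 1 / 2 < u j) = Sᶜ := by
  constructor
  · ext j
    simp only [Finset.mem_filter, Finset.mem_univ, true_and]
    exact ⟨fun h => by_contra fun hj => lt_asymm h ((hu j).2 hj), (hu j).1⟩
  · ext j
    simp only [Finset.mem_filter, Finset.mem_univ, true_and, Finset.mem_compl]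
    exact ⟨fun h hj => lt_asymm h ((hu j).1 hj), (hu j).2⟩

theorem exists_embedding_map_eq {n : ℕ} {T : Finset (Fin n)} {i : Fin n} (hi : i ∈ T) :
    ∃ (g : Fin T.card ↪ Fin n) (k : Fin T.card), Finset.univ.map g = T ∧ g k = i := by
  have h := Finset.map_orderEmbOfFin_univ T rfl
  obtain ⟨k, -, hk⟩ := Finset.mem_map.1 (h.ge hi)
  exact ⟨_, k, h, hk⟩

/-- The error involves only the coordinates selected by `g`, which form an i.i.d. sample from `μ`.
-/
theorem integral_subsample_rankError {n ν : ℕ} {S : Finset (Fin n)} {μ : Measure ℝ}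
    [IsProbabilityMeasure μ] {φ : ℝ → ℝ} (hφ : AEStronglyMeasurable φ μ) (c : ℕ → ℝ)
    (g : Fin ν ↪ Fin n) (hg : ∀ i, halfUniform S (g i) = μ) (k : Fin ν) :
    ∫ u, (c (rank (u ∘ g) k) - φ (u (g k))) ^ 2 ∂Measure.pi (halfUniform S) =
      rankRisk μ φ c ν := by
  have hmp := measurePreserving_pi_comp (halfUniform S) (fun _ => μ) g.injective hg
  rw [← integral_rankError_eq hφ c k, ← hmp.map_eq,
    integral_map hmp.measurable.aemeasurable
      (by rw [hmp.map_eq]; exact aestronglyMeasurable_rankError hφ c k)]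
  rfl

/-- The squared error of the scores for the standardised sample `u`, with median `1 / 2`. -/
noncomputable def uniformScoreError (φ : ℝ → ℝ) (a : ScoreFunctions) {m : ℕ}
    (u : Fin (m + 1) → ℝ) : ℝ :=
  (a (m + 1) ((Finset.univ.filter fun j => u j < 1 / 2).card,
    (Finset.univ.filter fun j => 1 / 2 < u j).card) (rank u 0) - φ (u 0)) ^ 2

/-- Every observation outside `S` exceeds `1/2`, hence exceeds `u 0`, so the rank of `u 0` is its
rank among the observations in `S`. It is at most `|S| = n - |Sᶜ|`, which switches the second
indicator off. -/
theorem integral_uniformScoreError_of_mem {φ : ℝ → ℝ}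
    (hφ : AEStronglyMeasurable φ (uniformIoo 0 (1 / 2))) (aMinus aPlus : ℕ → ℕ → ℝ) {m : ℕ}
    {S : Finset (Fin (m + 1))} (hS : 0 ∈ S) :
    ∫ u, uniformScoreError φ (combineScores aMinus aPlus) u ∂Measure.pi (halfUniform S) =
      rankRisk (uniformIoo 0 (1 / 2)) φ (aMinus S.card) S.card := by
  have : IsProbabilityMeasure (uniformIoo 0 (1 / 2)) :=
    isProbabilityMeasure_uniformIoo (by norm_num)
  obtain ⟨g, k, hgS, hk⟩ := exists_embedding_map_eq hS
  rw [← integral_subsample_rankError (S := S) hφ (aMinus S.card) g (fun i => if_pos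
    (hgS.le (Finset.mem_map_of_mem g (Finset.mem_univ i)))) k]
  refine integral_congr_ae ?_
  filter_upwards [ae_lt_half_iff_mem S] with u hu
  obtain ⟨hneg, hpos⟩ := filter_lt_half_eq hu
  have hrank : rank u 0 = rank (u ∘ g) k := by
    have h := rank_apply_eq_add u S g hgS k
    rw [hk] at h
    rw [h, add_eq_left, Finset.card_eq_zero]
    refine Finset.filter_eq_empty_iff.2 fun j hj h => ?_
    exact (((hu j).2 (Finset.mem_compl.1 hj)).trans_le h).not_ge ((hu 0).1 hS).le
  have hle := rank_le (u ∘ g) k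
  have hcard : S.card ≤ m + 1 := by simpa using Finset.card_le_univ S
  have hnot : ¬ m + 1 - (m + 1 - S.card) < rank (u ∘ g) k := by omega
  rw [uniformScoreError, hneg, hpos, hrank, hk, combineScores]
  simp only [Finset.card_compl, Fintype.card_fin, hle, hnot, if_true, if_false, add_zero]

/-- Every observation in `S` lies below `u 0`, so the rank is that within the complement shifted by
`|S|`; this is exactly the shift that the positive scores subtract. -/
theorem integral_uniformScoreError_of_notMem {φ : ℝ → ℝ}
    (hφ : AEStronglyMeasurable φ (uniformIoo (1 / 2) 1)) (aMinus aPlus : ℕ → ℕ → ℝ) {m : ℕ}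
    {S : Finset (Fin (m + 1))} (hS : 0 ∉ S) :
    ∫ u, uniformScoreError φ (combineScores aMinus aPlus) u ∂Measure.pi (halfUniform S) =
      rankRisk (uniformIoo (1 / 2) 1) φ (aPlus Sᶜ.card) Sᶜ.card := by
  have : IsProbabilityMeasure (uniformIoo (1 / 2) 1) :=
    isProbabilityMeasure_uniformIoo (by norm_num)
  obtain ⟨g, k, hgS, hk⟩ := exists_embedding_map_eq (Finset.mem_compl.2 hS)
  rw [← integral_subsample_rankError (S := S) hφ (aPlus Sᶜ.card) g (fun i => if_neg
    (Finset.mem_compl.1 (hgS.le (Finset.mem_map_of_mem g (Finset.mem_univ i))))) k]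
  refine integral_congr_ae ?_
  filter_upwards [ae_lt_half_iff_mem S] with u hu
  obtain ⟨hneg, hpos⟩ := filter_lt_half_eq hu
  have hrank : rank u 0 = rank (u ∘ g) k + S.card := by
    have h := rank_apply_eq_add u Sᶜ g hgS k
    rw [hk, compl_compl] at h
    rw [h, Finset.filter_true_of_mem fun j hj => (((hu j).1 hj).trans ((hu 0).2 hS)).le]
  have hle := one_le_rank (u ∘ g) k
  have hcard : S.card ≤ m + 1 := by simpa using Finset.card_le_univ S
  have hnot : ¬ rank (u ∘ g) k + S.card ≤ S.card := by omega
  have hcompl : Sᶜ.card = m + 1 - S.card := by simp [Finset.card_compl]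
  have hlt : m + 1 - Sᶜ.card < rank (u ∘ g) k + S.card := by omega
  have hsub : rank (u ∘ g) k + S.card - (m + 1 - Sᶜ.card) = rank (u ∘ g) k := by omega
  rw [uniformScoreError, hneg, hpos, hrank, hk, combineScores]
  simp only [hnot, hlt, hsub, if_true, if_false, zero_add]

theorem measurable_card_filter {n : ℕ} (s : Set ℝ) (hs : MeasurableSet s)
    [DecidablePred (· ∈ s)] :
    Measurable fun u : Fin n → ℝ => (Finset.univ.filter fun j => u j ∈ s).card := by
  simp only [Finset.card_filter]
  refine Finset.measurable_sum _ fun j _ => ?_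
  exact Measurable.ite (measurable_pi_apply j hs) measurable_const measurable_const

/-- For a fixed sample size the counts and the rank take finitely many values, so any score is
bounded. -/
theorem memLp_uniformScore {φ : ℝ → ℝ} (hφ : MemLp φ 2 (uniformIoo 0 1)) (a : ScoreFunctions)
    (m : ℕ) :
    MemLp (fun u : Fin (m + 1) → ℝ => a (m + 1) ((Finset.univ.filter fun j => u j < 1 / 2).card,
      (Finset.univ.filter fun j => 1 / 2 < u j).card) (rank u 0) - φ (u 0)) 2
      (Measure.pi fun _ => uniformIoo 0 1) := by
  have : IsProbabilityMeasure (uniformIoo 0 1) := isProbabilityMeasure_uniformIoo (by norm_num)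
  refine MemLp.sub ?_ (memLp_coordinate hφ 0)
  set b : (ℕ × ℕ) × ℕ → ℝ := fun p => a (m + 1) p.1 p.2
  have hm : Measurable fun u : Fin (m + 1) → ℝ =>
      (((Finset.univ.filter fun j => u j < 1 / 2).card,
        (Finset.univ.filter fun j => 1 / 2 < u j).card), rank u 0) :=
    ((measurable_card_filter (Set.Iio (1 / 2)) measurableSet_Iio).prodMk
      (measurable_card_filter (Set.Ioi (1 / 2)) measurableSet_Ioi)).prodMk (measurable_rank 0)
  have hcard : ∀ s : Finset (Fin (m + 1)), s.card ∈ Finset.range (m + 2) := fun s => by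
    have := Finset.card_le_univ s
    rw [Fintype.card_fin] at this
    exact Finset.mem_range.2 (by omega)
  refine MemLp.of_bound ((measurable_of_countable b).comp hm).aestronglyMeasurable
    (∑ p ∈ (Finset.range (m + 2) ×ˢ Finset.range (m + 2)) ×ˢ Finset.range (m + 2), |b p|)
    (ae_of_all _ fun u => ?_)
  exact Finset.single_le_sum (f := fun p => |b p|) (a := ((_, _), _)) (fun p _ => abs_nonneg _)
    (Finset.mk_mem_product (Finset.mk_mem_product (hcard _) (hcard _))
      (Finset.mem_range.2 (Nat.lt_succ_of_le (rank_le u 0))))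

/-- Each mixture component contributes one of two risks, according to whether `0 ∈ S`. Keeping both
removes the case distinction at no harm, since both tend to zero. -/
theorem integral_uniformScoreError_le {φ : ℝ → ℝ} (hφ : MemLp φ 2 (uniformIoo 0 1))
    (hφ₁ : AEStronglyMeasurable φ (uniformIoo 0 (1 / 2)))
    (hφ₂ : AEStronglyMeasurable φ (uniformIoo (1 / 2) 1)) (aMinus aPlus : ℕ → ℕ → ℝ) (m : ℕ) :
    ∫ u : Fin (m + 1) → ℝ, uniformScoreError φ (combineScores aMinus aPlus) u
        ∂(Measure.pi fun _ => uniformIoo 0 1) ≤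
      (1 / 2) ^ (m + 1) * ∑ S : Finset (Fin (m + 1)),
        (rankRisk (uniformIoo 0 (1 / 2)) φ (aMinus S.card) S.card +
          rankRisk (uniformIoo (1 / 2) 1) φ (aPlus S.card) S.card) := by
  have : IsProbabilityMeasure (uniformIoo 0 (1 / 2)) :=
    isProbabilityMeasure_uniformIoo (by norm_num)
  have : IsProbabilityMeasure (uniformIoo (1 / 2) 1) :=
    isProbabilityMeasure_uniformIoo (by norm_num)
  have hint : Integrable (fun u : Fin (m + 1) → ℝ =>
      uniformScoreError φ (combineScores aMinus aPlus) u)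
      (Measure.pi fun _ => uniformIoo 0 1) := (memLp_uniformScore hφ _ m).integrable_sq
  have hpi : Measure.pi (fun _ : Fin (m + 1) => uniformIoo 0 1) =
      ∑ S : Finset (Fin (m + 1)), (2⁻¹ : ℝ≥0∞) ^ (m + 1) • Measure.pi (halfUniform S) := by
    rw [uniformIoo_zero_one_eq, pi_smul_add_eq_sum _ (by simp)]
    rfl
  rw [hpi] at hint ⊢
  rw [integral_finsetSum_measure fun S hS =>
    (integrable_finsetSum_measure.1 hint S hS)]
  simp only [integral_smul_measure, smul_eq_mul]
  rw [← Finset.mul_sum, Finset.sum_add_distrib]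
  have hc : ((2⁻¹ : ℝ≥0∞) ^ (m + 1)).toReal = (1 / 2) ^ (m + 1) := by simp
  rw [hc]
  refine mul_le_mul_of_nonneg_left ?_ (by positivity)
  -- Complementation permutes the subsets, which lets the second risk be written in terms of
  -- `S.card`.
  rw [← Equiv.sum_comp (compl_involutive.toPerm (compl : Finset (Fin (m + 1)) → Finset (Fin (m + 1))))
    (fun S => rankRisk (uniformIoo (1 / 2) 1) φ (aPlus S.card) S.card), ← Finset.sum_add_distrib]
  refine Finset.sum_le_sum fun S _ => ?_
  by_cases hS : 0 ∈ S
  · rw [integral_uniformScoreError_of_mem hφ₁ aMinus aPlus hS]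
    exact le_add_of_nonneg_right (rankRisk_nonneg _ _ _ _)
  · rw [integral_uniformScoreError_of_notMem hφ₂ aMinus aPlus hS]
    exact le_add_of_nonneg_left (rankRisk_nonneg _ _ _ _)

/-- Averages over random subsets of a sequence that tends to zero tend to zero. -/
theorem tendsto_average_card_subset {r : ℕ → ℝ} (hr0 : ∀ n, 0 ≤ r n)
    (hr : Tendsto r atTop (𝓝 0)) :
    Tendsto (fun n : ℕ => (1 / 2 : ℝ) ^ n * ∑ S : Finset (Fin n), r S.card) atTop (𝓝 0) := by
  rw [Metric.tendsto_atTop]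
  intro ε hε
  obtain ⟨K, hK⟩ := (hr.eventually (gt_mem_nhds (half_pos hε))).exists_forall_of_atTop
  set B : ℝ := ∑ k ∈ Finset.range K, r k * 2 ^ k with hB
  -- The finitely many large terms are absorbed into a geometric sequence, chosen because the mean
  -- of `(1/2) ^ |S|` over all subsets is `(3/4) ^ n`.
  have hbound : ∀ k, r k ≤ ε / 2 + B * (1 / 2) ^ k := by
    intro k
    have hB0 : 0 ≤ B := Finset.sum_nonneg fun k _ => mul_nonneg (hr0 k) (by positivity)
    rcases lt_or_ge k K with hk | hk
    · have h1 : r k * 2 ^ k ≤ B :=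
        Finset.single_le_sum (f := fun k => r k * 2 ^ k)
          (fun k _ => mul_nonneg (hr0 k) (by positivity)) (Finset.mem_range.2 hk)
      have h2 : r k = r k * 2 ^ k * (1 / 2) ^ k := by
        rw [mul_assoc, ← mul_pow]; norm_num
      have h3 : r k * 2 ^ k * (1 / 2) ^ k ≤ B * (1 / 2) ^ k :=
        mul_le_mul_of_nonneg_right h1 (by positivity)
      linarith
    · have h1 := hK k hk
      have h2 : 0 ≤ B * (1 / 2) ^ k := by positivity
      linarith
  have hsum : ∀ n : ℕ, (1 / 2 : ℝ) ^ n * ∑ S : Finset (Fin n), r S.card ≤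
      ε / 2 + B * (3 / 4) ^ n := by
    intro n
    have h1 : ∑ S : Finset (Fin n), (1 / 2 : ℝ) ^ S.card = (3 / 2) ^ n := by
      have := Fin.sum_pow_mul_eq_add_pow (n := n) (1 / 2 : ℝ) 1
      simp only [one_pow, mul_one] at this
      rw [this]
      norm_num
    calc (1 / 2 : ℝ) ^ n * ∑ S : Finset (Fin n), r S.card
        ≤ (1 / 2 : ℝ) ^ n * ∑ S : Finset (Fin n), (ε / 2 + B * (1 / 2) ^ S.card) := by
          gcongr
          exact hbound _
      _ = (1 / 2 : ℝ) ^ n * (2 ^ n * (ε / 2) + B * (3 / 2) ^ n) := by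
          rw [Finset.sum_add_distrib, ← Finset.mul_sum, h1]
          simp
      _ = ((1 / 2) * 2) ^ n * (ε / 2) + B * ((1 / 2) * (3 / 2)) ^ n := by
          rw [mul_pow, mul_pow]; ring
      _ = ε / 2 + B * (3 / 4) ^ n := by norm_num
  have hgeom : Tendsto (fun n : ℕ => B * (3 / 4 : ℝ) ^ n) atTop (𝓝 0) := by
    have := (tendsto_pow_atTop_nhds_zero_of_lt_one (r := (3 / 4 : ℝ)) (by norm_num)
      (by norm_num)).const_mul B
    rwa [mul_zero] at this
  obtain ⟨N, hN⟩ := (hgeom.eventually (gt_mem_nhds (half_pos hε))).exists_forall_of_atTop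
  refine ⟨N, fun n hn => ?_⟩
  rw [Real.dist_eq, sub_zero, abs_of_nonneg
    (mul_nonneg (by positivity) (Finset.sum_nonneg fun _ _ => hr0 _))]
  linarith [hsum n, hN n hn]

/-! ### The probability integral transform -/

section DistFun

variable {f : ℝ → ℝ}

theorem distFun_zero (hf : IsZeroMedianDensity f) : distFun f 0 = 1 / 2 := by
  rw [distFun, integral_Iic_eq_integral_Iio, hf.integral_neg]

theorem distFun_eq_add (hf : IsZeroMedianDensity f) (x : ℝ) :
    distFun f x = 1 / 2 + ∫ t in (0 : ℝ)..x, f t := by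
  rw [← distFun_zero hf, distFun, distFun, ← intervalIntegral.integral_Iic_sub_Iic
    hf.integrable.integrableOn hf.integrable.integrableOn]
  ring

/-- Positivity of the density enters here; it makes `F` preserve all comparisons between
observations. -/
theorem strictMono_distFun (hf : IsZeroMedianDensity f) : StrictMono (distFun f) := by
  intro x y hxy
  rw [← sub_pos, distFun, distFun, intervalIntegral.integral_Iic_sub_Iic
    hf.integrable.integrableOn hf.integrable.integrableOn]
  exact intervalIntegral.intervalIntegral_pos_of_pos hf.integrable.intervalIntegrable hf.pos hxy

theorem continuous_distFun (hf : IsZeroMedianDensity f) : Continuous (distFun f) := by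
  rw [funext (distFun_eq_add hf)]
  exact continuous_const.add
    (intervalIntegral.continuous_primitive (fun a b => hf.integrable.intervalIntegrable) 0)

theorem tendsto_distFun_atTop (hf : IsZeroMedianDensity f) :
    Tendsto (distFun f) atTop (𝓝 1) := by
  rw [funext (distFun_eq_add hf)]
  have := (intervalIntegral_tendsto_integral_Ioi 0 hf.integrable.integrableOn
    tendsto_id).const_add (1 / 2)
  rw [hf.integral_pos] at this
  norm_num at this ⊢
  exact this

theorem tendsto_distFun_atBot (hf : IsZeroMedianDensity f) :
    Tendsto (distFun f) atBot (𝓝 0) := by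
  rw [funext (distFun_eq_add hf)]
  have := (intervalIntegral_tendsto_integral_Iic 0 hf.integrable.integrableOn
    tendsto_id).const_sub (1 / 2)
  rw [integral_Iic_eq_integral_Iio, hf.integral_neg, sub_self] at this
  refine this.congr fun x => ?_
  rw [intervalIntegral.integral_symm 0, sub_neg_eq_add]
  rfl

theorem distFun_mem_Ioo (hf : IsZeroMedianDensity f) (x : ℝ) : distFun f x ∈ Set.Ioo 0 1 := by
  have hm := strictMono_distFun hf
  exact ⟨(hm.monotone.le_of_tendsto (tendsto_distFun_atBot hf) (x - 1)).trans_lt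
      (hm (sub_one_lt x)),
    (hm (lt_add_one x)).trans_le (hm.monotone.ge_of_tendsto (tendsto_distFun_atTop hf) (x + 1))⟩

theorem exists_distFun_eq (hf : IsZeroMedianDensity f) {p : ℝ} (hp : p ∈ Set.Ioo 0 1) :
    ∃ x, distFun f x = p := by
  obtain ⟨a, ha⟩ := ((tendsto_distFun_atBot hf).eventually (gt_mem_nhds hp.1)).exists
  obtain ⟨b, hb⟩ := ((tendsto_distFun_atTop hf).eventually (lt_mem_nhds hp.2)).exists
  exact mem_range_of_exists_le_of_exists_ge (continuous_distFun hf) ⟨a, ha.le⟩ ⟨b, hb.le⟩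

/-- The distribution function of a random variable with density `f` is uniform. -/
theorem map_distFun_eq (hf : IsZeroMedianDensity f)
    (hprob : IsProbabilityMeasure (volume.withDensity fun x => ENNReal.ofReal (f x))) :
    (volume.withDensity fun x => ENNReal.ofReal (f x)).map (distFun f) = uniformIoo 0 1 := by
  have : IsProbabilityMeasure (uniformIoo 0 1) := isProbabilityMeasure_uniformIoo (by norm_num)
  set ν := volume.withDensity fun x => ENNReal.ofReal (f x)
  have hF : Measurable (distFun f) := (continuous_distFun hf).measurable
  have hm := strictMono_distFun hf
  refine Measure.ext_of_Iic _ _ fun p => ?_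
  rw [Measure.map_apply hF measurableSet_Iic]
  rcases le_or_gt p 0 with hp0 | hp0
  · have h1 : distFun f ⁻¹' Set.Iic p = ∅ := Set.eq_empty_of_forall_notMem fun x hx =>
      (distFun_mem_Ioo hf x).1.not_ge (le_trans hx hp0)
    have h2 : Set.Ioo (0 : ℝ) 1 ∩ Set.Iic p = ∅ := Set.eq_empty_of_forall_notMem fun x hx =>
      hx.1.1.not_ge (le_trans hx.2 hp0)
    rw [h1, uniformIoo, cond_apply measurableSet_Ioo, h2]
    simp
  rcases le_or_gt 1 p with hp1 | hp1
  · have h1 : distFun f ⁻¹' Set.Iic p = Set.univ := Set.eq_univ_of_forall fun x =>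
      (distFun_mem_Ioo hf x).2.le.trans hp1
    rw [h1, measure_univ, eq_comm, prob_compl_eq_zero_iff measurableSet_Iic |>.symm]
    refine measure_mono_null (t := (Set.Ioo (0 : ℝ) 1)ᶜ) ?_ (ae_mem_uniformIoo 0 1)
    exact Set.compl_subset_compl.2 fun x hx => hx.2.le.trans hp1
  -- For `p = F x` the preimage of the half-line up to `p` is the half-line up to `x`, of mass `F x
  -- = p`.
  obtain ⟨x, hx⟩ := exists_distFun_eq hf ⟨hp0, hp1⟩
  have h1 : distFun f ⁻¹' Set.Iic p = Set.Iic x := by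
    ext y
    rw [← hx]
    exact hm.le_iff_le
  have h2 := uniformIoo_real_Iic (l := 0) (r := 1) ⟨hp0, hp1⟩
  rw [sub_zero, sub_zero, div_one] at h2
  rw [h1, withDensity_apply _ measurableSet_Iic,
    ← ofReal_integral_eq_lintegral_ofReal hf.integrable.integrableOn
      (ae_of_all _ fun y => (hf.pos y).le), ← ofReal_measureReal, h2, ← hx]
  rfl

/-- Ranks and sign counts depend only on comparisons between observations and with `0`, and `F`
preserves these, carrying `0` to `1/2`. -/
theorem scoreError_eq (hf : IsZeroMedianDensity f) (φ : ℝ → ℝ) (a : ScoreFunctions) {m : ℕ}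
    (z : Fin (m + 1) → ℝ) :
    scoreError φ a f z = uniformScoreError φ a (distFun f ∘ z) := by
  have hm := strictMono_distFun hf
  have h0 := distFun_zero hf
  simp only [scoreError, uniformScoreError, rank, numNeg, numPos, Function.comp_apply, ← h0,
    hm.le_iff_le, hm.lt_iff_lt]

variable {Ω : Type*} [MeasurableSpace Ω] {P : Measure Ω} [IsProbabilityMeasure P]

theorem measurePreserving_distFun_comp (hf : IsZeroMedianDensity f) {n : ℕ}
    {Z : Fin n → Ω → ℝ} (hZ : IsIIDWithDensity P Z f) :
    MeasurePreserving (fun ω j => distFun f (Z j ω)) P (Measure.pi fun _ => uniformIoo 0 1) := by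
  have hF : Measurable (distFun f) := (continuous_distFun hf).measurable
  have hm : ∀ j, Measurable fun ω => distFun f (Z j ω) := fun j => hF.comp (hZ.measurable j)
  refine ⟨measurable_pi_lambda _ hm, ?_⟩
  rw [(iIndepFun_iff_map_fun_eq_pi_map fun j => (hm j).aemeasurable).1
    (hZ.indep.comp (fun _ => distFun f) fun _ => hF)]
  congr 1
  ext1 j
  have hprob : IsProbabilityMeasure (P.map (Z j)) :=
    Measure.isProbabilityMeasure_map (hZ.measurable j).aemeasurable
  rw [← map_distFun_eq hf (hZ.law j ▸ hprob), ← hZ.law j, Measure.map_map hF (hZ.measurable j)]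
  rfl

theorem integrable_scoreError (hf : IsZeroMedianDensity f) {φ : ℝ → ℝ}
    (hφ : MemLp φ 2 (uniformIoo 0 1)) (a : ScoreFunctions) {m : ℕ} {Z : Fin (m + 1) → Ω → ℝ}
    (hZ : IsIIDWithDensity P Z f) :
    Integrable (fun ω => scoreError φ a f fun i => Z i ω) P := by
  simp only [scoreError_eq hf]
  exact (measurePreserving_distFun_comp hf hZ).integrable_comp_of_integrable
    (memLp_uniformScore hφ a m).integrable_sq

theorem integral_scoreError_eq (hf : IsZeroMedianDensity f) {φ : ℝ → ℝ}
    (hφ : MemLp φ 2 (uniformIoo 0 1)) (a : ScoreFunctions) {m : ℕ} {Z : Fin (m + 1) → Ω → ℝ}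
    (hZ : IsIIDWithDensity P Z f) :
    ∫ ω, scoreError φ a f (fun i => Z i ω) ∂P =
      ∫ u, uniformScoreError φ a u ∂(Measure.pi fun _ : Fin (m + 1) => uniformIoo 0 1) := by
  have hmp := measurePreserving_distFun_comp hf hZ
  simp only [scoreError_eq hf]
  conv_rhs => rw [← hmp.map_eq]
  rw [integral_map hmp.measurable.aemeasurable
    (by rw [hmp.map_eq]; exact (memLp_uniformScore hφ a m).1.pow 2)]
  rfl

/-- Markov's inequality for the conditional expectation of a nonnegative random variable. -/
theorem measure_le_abs_condExp_le {X : Ω → ℝ} (hX0 : 0 ≤ X)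
    (m : MeasurableSpace Ω) {ε : ℝ} (hε : 0 < ε) :
    P {ω | ε ≤ |(P[X|m]) ω|} ≤ ENNReal.ofReal (ε⁻¹ * ∫ ω, X ω ∂P) := by
  have h1 := mul_meas_ge_le_integral_of_nonneg (μ := P) (f := fun ω => |(P[X|m]) ω|)
    (ae_of_all _ fun ω => abs_nonneg _) integrable_condExp.abs ε
  have h2 : ∫ ω, |(P[X|m]) ω| ∂P ≤ ∫ ω, X ω ∂P := by
    refine (integral_abs_condExp_le X).trans_eq ?_
    exact integral_congr_ae (ae_of_all _ fun ω => abs_of_nonneg (hX0 ω))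
  rw [← ofReal_measureReal]
  refine ENNReal.ofReal_le_ofReal ?_
  rw [le_inv_mul_iff₀ hε]
  exact h1.trans h2

end DistFun

/-! ### From the half-samples to the full sample -/

/-- `φ` is score-generating for scores that are consistent within each of the two half-samples. -/
theorem isScoreGenerating_combineScores {φ : ℝ → ℝ} (hφ : MemLp φ 2 (uniformIoo 0 1))
    (hφ₁ : AEStronglyMeasurable φ (uniformIoo 0 (1 / 2)))
    (hφ₂ : AEStronglyMeasurable φ (uniformIoo (1 / 2) 1)) {aMinus aPlus : ℕ → ℕ → ℝ}
    (hMinus : Tendsto (fun ν => rankRisk (uniformIoo 0 (1 / 2)) φ (aMinus ν) ν) atTop (𝓝 0))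
    (hPlus : Tendsto (fun ν => rankRisk (uniformIoo (1 / 2) 1) φ (aPlus ν) ν) atTop (𝓝 0)) :
    IsScoreGenerating.{u} φ (combineScores aMinus aPlus) := by
  intro f hf Ω _ P _ Z hZ
  have hint := fun m => integrable_scoreError hf hφ (combineScores aMinus aPlus) (hZ m)
  refine ⟨hint, fun ε hε => ?_⟩
  have hsum := hMinus.add hPlus
  rw [add_zero] at hsum
  have havg := tendsto_average_card_subset (fun n => add_nonneg (rankRisk_nonneg _ _ _ _)
    (rankRisk_nonneg _ _ _ _)) hsum
  rw [← tendsto_add_atTop_iff_nat 1] at havg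
  have hlim := ENNReal.tendsto_ofReal (havg.const_mul ε⁻¹)
  rw [mul_zero, ENNReal.ofReal_zero] at hlim
  refine tendsto_of_tendsto_of_tendsto_of_le_of_le tendsto_const_nhds hlim
    (fun m => zero_le) fun m => ?_
  -- The conditional statement is reduced here to the mean of the squared error.
  refine (measure_le_abs_condExp_le (fun ω => sq_nonneg _) _ hε).trans
    (ENNReal.ofReal_le_ofReal (mul_le_mul_of_nonneg_left ?_ (by positivity)))
  exact (integral_scoreError_eq hf hφ _ (hZ m)).trans_le
    (integral_uniformScoreError_le hφ hφ₁ hφ₂ aMinus aPlus m)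

theorem uniformOrderMean_succ (φ : ℝ → ℝ) (l r : ℝ) (ν : ℕ) (i : Fin ν) :
    uniformOrderMean φ l r ν (i + 1) =
      ∫ u : Fin ν → ℝ, φ (orderStatistics u i) ∂Measure.pi fun _ => uniformIoo l r := by
  rw [uniformOrderMean, dif_pos ⟨Nat.le_add_left _ _, i.2⟩]
  rfl

end SignRank

theorem proposition3p1 (φ : ℝ → ℝ)
    (hnonconst : ¬ ∃ c : ℝ, ∀ x ∈ Set.Ioo (0 : ℝ) 1, φ x = c)
    (hφ : SignRank.SquareIntegrable φ) :
    SignRank.IsScoreGenerating.{u} φ (SignRank.exactScores φ) ∧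
    ((∃ φ₁ φ₂ : ℝ → ℝ,
        MonotoneOn φ₁ (Set.Ioo (0 : ℝ) 1) ∧ MonotoneOn φ₂ (Set.Ioo (0 : ℝ) 1) ∧
        SignRank.SquareIntegrable φ₁ ∧ SignRank.SquareIntegrable φ₂ ∧
        ∀ x ∈ Set.Ioo (0 : ℝ) 1, φ x = φ₁ x - φ₂ x) →
      SignRank.IsScoreGenerating.{u} φ (SignRank.approxScores φ)) := by
  have sub₁ : Set.Ioo (0 : ℝ) (1 / 2) ⊆ Set.Ioo 0 1 := Set.Ioo_subset_Ioo le_rfl (by norm_num)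
  have sub₂ : Set.Ioo (1 / 2 : ℝ) 1 ⊆ Set.Ioo 0 1 := Set.Ioo_subset_Ioo (by norm_num) le_rfl
  have lt₁ : (0 : ℝ) < 1 / 2 := by norm_num
  have lt₂ : (1 / 2 : ℝ) < 1 := by norm_num
  have restr₁ : ∀ {g : ℝ → ℝ}, SignRank.SquareIntegrable g →
      MemLp g 2 (SignRank.uniformIoo 0 (1 / 2)) := fun hg =>
    SignRank.memLp_uniformIoo lt₁ (hg.mono_measure (Measure.restrict_mono sub₁ le_rfl))
  have restr₂ : ∀ {g : ℝ → ℝ}, SignRank.SquareIntegrable g →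
      MemLp g 2 (SignRank.uniformIoo (1 / 2) 1) := fun hg =>
    SignRank.memLp_uniformIoo lt₂ (hg.mono_measure (Measure.restrict_mono sub₂ le_rfl))
  have hφ₀ := SignRank.memLp_uniformIoo one_pos hφ
  constructor
  · exact SignRank.isScoreGenerating_combineScores hφ₀ (restr₁ hφ).1 (restr₂ hφ).1
      (SignRank.tendsto_rankRisk_of_eq_integral lt₁ (restr₁ hφ)
        (SignRank.uniformOrderMean_succ φ 0 (1 / 2)))
      (SignRank.tendsto_rankRisk_of_eq_integral lt₂ (restr₂ hφ)
        (SignRank.uniformOrderMean_succ φ (1 / 2) 1))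
  · rintro ⟨φ₁, φ₂, m₁, m₂, h₁, h₂, heq⟩
    have hMinus := SignRank.tendsto_rankRisk_of_eqOn_sub lt₁ (restr₁ h₁) (restr₁ h₂)
      (m₁.mono sub₁) (m₂.mono sub₁) fun x hx => heq x (sub₁ hx)
    have hPlus := SignRank.tendsto_rankRisk_of_eqOn_sub lt₂ (restr₂ h₁) (restr₂ h₂)
      (m₁.mono sub₂) (m₂.mono sub₂) fun x hx => heq x (sub₂ hx)
    refine SignRank.isScoreGenerating_combineScores hφ₀ (restr₁ hφ).1 (restr₂ hφ).1 ?_ ?_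
    -- The arguments of the approximate scores are the grid points of the half-interval: `(1/2) · i
    -- / (ν + 1) = i / (2(ν + 1))`.
    · convert! hMinus using 5 with ν i
      simp only [SignRank.gridPoint]
      field_simp
      ring
    · convert! hPlus using 5 with ν i
      simp only [SignRank.gridPoint]
      field_simp
      ring
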